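/- Let $s>1$, write $s=m+\alpha$ with $m=\lceil s\rceil-1$ and $\alpha\in(0,1]$. For a compact interval $I$, let $\mathcal C^s(I)$ be the set of $m$ times continuously differentiable functions $\psi$ on $I$ with finite norm $$\|\psi\|_{\mathcal C^s}=\sup_{0\le n\le m}\|\psi^{(n)}\|_{L^\infty(I)}+\sup_{x\ne y\in I}\frac{|\psi^{(m)}(x)-\psi^{(m)}(y)|}{|x-y|^{\alpha}}$$ (so an integer $s$ means Lipschitz derivatives up to order $s-1$). A set $\Omega\subset\mathbb R^2$ is a $\mathcal C^s$ domain if there are $R>0$, $P>1$, $M>0$ such that for every $z_0\in\partial\Omega$ there are an orthonormal system $(e_1,e_2)$ and $\psi\in\mathcal C^s([-R,R])$ with $\|\psi\|_{\mathcal C^s}\le M$ and values in $[-PR,PR]$ such that, for all $|z_1|\le R$ and $|z_2|\le PR$, $z_0+z_1e_1+z_2e_2\in\Omega$ if and only if $z_2\le\psi(z_1)$. For $h>0$ and $(i,j)\in\mathbb Z^2$ let $T_{i,j}=[ih,(i+1)h]\times[jh,(j+1)h]$ and let $a_{i,j}=|T_{i,j}\cap\Omega|/h^2$ be the average of $\chi_\Omega$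 on $T_{i,j}$. The cell $T_{i,j}$ is singular if $|T_{i,j}\cap\Omega|\neq 0$ and $|T_{i,j}\cap\Omega^c|\ne 0$. The Sobel gradient at $T=T_{i,j}$ is $(H_T,V_T)$, where $$H_T=2a_{i+1,j}+a_{i+1,j+1}+a_{i+1,j-1}-(2a_{i-1,j}+a_{i-1,j+1}+a_{i-1,j-1}),$$ $$V_T=2a_{i,j+1}+a_{i+1,j+1}+a_{i-1,j+1}-(2a_{i,j-1}+a_{i+1,j-1}+a_{i-1,j-1}).$$ **Theorem.** Let $\Omega\subset\mathbb R^2$ be a $\mathcal C^s$ domain for some $s>1$, let $k\ge1$ be an integer and $l=k+2$. There exists $h^*>0$ (depending on $\Omega$, $s$, $k$) such that for all $0<h<h^*$ and every singular cell $T=T_{i,j}$ the following holds. In cases 1 and 2 below let $S_T$ be the stencil of $(2k+1)\times(2l+1)$ cells centered at $T$ ($2k+1$ columns, $2l+1$ rows), in cases 3 and 4 the stencil of $(2l+1)\times(2k+1)$ cells centered at $T$; let $I\times J$ be the union of the cells of $S_T$. 1. If $|V_T|\ge|H_T|$ and $V_T\le0$, there is $\psi\in\mathcal C^s(I)$ with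 $\psi(I)\subset J$ such that for all $(x,y)\in I\times J$: $(x,y)\in\Omega\iff y\le\psi(x)$. 2. If $|V_T|\ge|H_T|$ and $V_T>0$, there is $\psi\in\mathcal C^s(I)$ with $\psi(I)\subset J$ such that for all $(x,y)\in I\times J$: $(x,y)\in\Omega\iff y\ge\psi(x)$. 3. If $|V_T|<|H_T|$ and $H_T\le0$, there is $\psi\in\mathcal C^s(J)$ with $\psi(J)\subset I$ such that for all $(x,y)\in I\times J$: $(x,y)\in\Omega\iff x\le\psi(y)$. 4. If $|V_T|<|H_T|$ and $H_T>0$, there is $\psi\in\mathcal C^s(J)$ with $\psi(J)\subset I$ such that for all $(x,y)\in I\times J$: $(x,y)\in\Omega\iff x\ge\psi(y)$. -/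

import Mathlib

open Set MeasureTheory

noncomputable section

/-- The integer part `m = ⌈s⌉ - 1` of the smoothness `s > 0`: one has `s = m + α` with
`0 < α ≤ 1`, so that an integer `s` means Lipschitz derivatives up to order `s - 1`. -/
def holderOrder (s : ℝ) : ℕ := ⌈s⌉₊ - 1

/-- `ψ` is of class `C^s` on the interval `I`, with Hölder norm
`sup_{n ≤ m} ‖ψ^(n)‖_∞ + sup_{x ≠ y} |ψ^(m) x - ψ^(m) y| / |x - y| ^ α` at most `M`,
where `m = ⌈s⌉ - 1` and `α = s - m`. The numbers `A` and `B` bound the two terms. -/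
def HolderNormLE (s : ℝ) (I : Set ℝ) (ψ : ℝ → ℝ) (M : ℝ) : Prop :=
  ContDiffOn ℝ (holderOrder s) ψ I ∧
  ∃ A B : ℝ, 0 ≤ A ∧ 0 ≤ B ∧ A + B ≤ M ∧
    (∀ n ≤ holderOrder s, ∀ x ∈ I, |iteratedDerivWithin n ψ I x| ≤ A) ∧
    (∀ x ∈ I, ∀ y ∈ I,
      |iteratedDerivWithin (holderOrder s) ψ I x - iteratedDerivWithin (holderOrder s) ψ I y|
        ≤ B * |x - y| ^ (s - (holderOrder s : ℝ)))

/-- `ψ` belongs to `C^s(I)`. -/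
def HolderClass (s : ℝ) (I : Set ℝ) (ψ : ℝ → ℝ) : Prop := ∃ M : ℝ, HolderNormLE s I ψ M

/-- `(e₁, e₂)` is an orthonormal system of the Euclidean plane. The plane is `ℝ × ℝ`, whose
built-in norm is the maximum norm, hence the explicit coordinates. -/
def IsOrthonormalPair (e₁ e₂ : ℝ × ℝ) : Prop :=
  e₁.1 ^ 2 + e₁.2 ^ 2 = 1 ∧ e₂.1 ^ 2 + e₂.2 ^ 2 = 1 ∧ e₁.1 * e₂.1 + e₁.2 * e₂.2 = 0

/-- Planar domains of class `C^s`: with uniform `R`, `P`, `M`, around each boundary point and in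
a suitable orthonormal frame centered there, the domain is the subgraph of a `C^s` function. -/
def IsHolderDomain (s : ℝ) (Ω : Set (ℝ × ℝ)) : Prop :=
  ∃ R P M : ℝ, 0 < R ∧ 1 < P ∧ 0 < M ∧
    ∀ z₀ ∈ frontier Ω, ∃ (e₁ e₂ : ℝ × ℝ) (ψ : ℝ → ℝ),
      IsOrthonormalPair e₁ e₂ ∧
      HolderNormLE s (Icc (-R) R) ψ M ∧
      MapsTo ψ (Icc (-R) R) (Icc (-(P * R)) (P * R)) ∧
      ∀ t₁ t₂ : ℝ, |t₁| ≤ R → |t₂| ≤ P * R →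
        (z₀ + t₁ • e₁ + t₂ • e₂ ∈ Ω ↔ t₂ ≤ ψ t₁)

/-- The cell `h ((i, j) + [0, 1]²)` of the uniform cartesian mesh of side-length `h`. -/
def meshCell (h : ℝ) (i j : ℤ) : Set (ℝ × ℝ) :=
  Icc (i * h) ((i + 1) * h) ×ˢ Icc (j * h) ((j + 1) * h)

/-- The average of the characteristic function of `Ω` on the cell of coordinates `(i, j)`. -/
def cellAverage (Ω : Set (ℝ × ℝ)) (h : ℝ) (i j : ℤ) : ℝ :=
  ⨍ z in meshCell h i j, Ω.indicator (fun _ => (1 : ℝ)) z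

/-- The cell meets both `Ω` and its complement in positive measure. -/
def IsSingularCell (Ω : Set (ℝ × ℝ)) (h : ℝ) (i j : ℤ) : Prop :=
  volume (meshCell h i j ∩ Ω) ≠ 0 ∧ volume (meshCell h i j ∩ Ωᶜ) ≠ 0

/-- Horizontal component of the Sobel numerical gradient at the cell `(i, j)`. -/
def sobelH (Ω : Set (ℝ × ℝ)) (h : ℝ) (i j : ℤ) : ℝ :=
  2 * cellAverage Ω h (i + 1) j + cellAverage Ω h (i + 1) (j + 1)
      + cellAverage Ω h (i + 1) (j - 1)
    - (2 * cellAverage Ω h (i - 1) j + cellAverage Ω h (i - 1) (j + 1)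
      + cellAverage Ω h (i - 1) (j - 1))

/-- Vertical component of the Sobel numerical gradient at the cell `(i, j)`. -/
def sobelV (Ω : Set (ℝ × ℝ)) (h : ℝ) (i j : ℤ) : ℝ :=
  2 * cellAverage Ω h i (j + 1) + cellAverage Ω h (i + 1) (j + 1)
      + cellAverage Ω h (i - 1) (j + 1)
    - (2 * cellAverage Ω h i (j - 1) + cellAverage Ω h (i + 1) (j - 1)
      + cellAverage Ω h (i - 1) (j - 1))

/-- The total support of the stencil of `(2 p + 1) × (2 q + 1)` cells (`2 p + 1` columns and
`2 q + 1` rows) centered at the cell `(i, j)`. -/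
def stencilSupport (h : ℝ) (i j : ℤ) (p q : ℕ) : Set (ℝ × ℝ) :=
  ⋃ a ∈ Icc (i - p) (i + p), ⋃ b ∈ Icc (j - q) (j + q), meshCell h a b

/-- The union of the `2 p + 1` mesh intervals centered at the interval `[i h, (i + 1) h]`. -/
def stencilInterval (h : ℝ) (i : ℤ) (p : ℕ) : Set ℝ :=
  Icc ((i - p) * h) ((i + p + 1) * h)

theorem mem_stencilInterval_iff {h : ℝ} (hh : 0 < h) (i : ℤ) (p : ℕ) (x : ℝ) :
    x ∈ stencilInterval h i p ↔
      ∃ a ∈ Icc (i - (p : ℤ)) (i + p), x ∈ Icc ((a : ℝ) * h) ((a + 1) * h) := by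
  constructor
  · rintro ⟨h1, h2⟩
    rcases eq_or_lt_of_le h2 with h2 | h2
    · exact ⟨i + p, ⟨by lia, le_rfl⟩, by push_cast; nlinarith, by push_cast; linarith⟩
    · have e1 : (i : ℝ) - p ≤ x / h := (le_div_iff₀ hh).2 h1
      have e2 : x / h < (i : ℝ) + p + 1 := (div_lt_iff₀ hh).2 h2
      refine ⟨⌊x / h⌋, ⟨Int.le_floor.2 (by push_cast; exact e1), ?_⟩,
        (le_div_iff₀ hh).1 (Int.floor_le _), ((div_lt_iff₀ hh).1 (Int.lt_floor_add_one _)).le⟩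
      exact Int.lt_add_one_iff.1 (Int.floor_lt.2 (by push_cast; exact e2))
  · rintro ⟨a, ⟨ha1, ha2⟩, h1, h2⟩
    have e1 : (i : ℝ) - p ≤ a := by exact_mod_cast ha1
    have e2 : (a : ℝ) ≤ i + p := by exact_mod_cast ha2
    exact ⟨by nlinarith, by nlinarith⟩

/-- The total support of a stencil is the product `I × J` of its two intervals. -/
theorem stencilSupport_eq {h : ℝ} (hh : 0 < h) (i j : ℤ) (p q : ℕ) :
    stencilSupport h i j p q = stencilInterval h i p ×ˢ stencilInterval h j q := by
  ext ⟨x, y⟩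
  rw [mem_prod, mem_stencilInterval_iff hh, mem_stencilInterval_iff hh]
  simp only [stencilSupport, meshCell, mem_iUnion, mem_prod, exists_prop]
  constructor
  · rintro ⟨a, ha, b, hb, hx, hy⟩
    exact ⟨⟨a, ha, hx⟩, ⟨b, hb, hy⟩⟩
  · rintro ⟨⟨a, ha, hx⟩, ⟨b, hb, hy⟩⟩
    exact ⟨a, ha, b, hb, hx, hy⟩

end

open Filter Topology

/-- The functions whose derivative of order `m` on `I` exists and is Hölder continuous of
exponent `a`, described recursively. -/
def HolderRec (a : ℝ) (I : Set ℝ) : ℕ → (ℝ → ℝ) → Prop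
  | 0, f => ∃ B, 0 ≤ B ∧ ∀ x ∈ I, ∀ y ∈ I, |f x - f y| ≤ B * |x - y| ^ a
  | m + 1, f => ∃ g, (∀ x ∈ I, HasDerivWithinAt f (g x) I x) ∧ HolderRec a I m g

namespace HolderRec

variable {a u v : ℝ} {I J : Set ℝ} {m : ℕ} {f g : ℝ → ℝ}

theorem congr (hf : HolderRec a I m f) (h : ∀ x ∈ I, g x = f x) : HolderRec a I m g := by
  cases m with
  | zero =>
    obtain ⟨B, hB, H⟩ := hf
    exact ⟨B, hB, fun x hx y hy => by rw [h x hx, h y hy]; exact H x hx y hy⟩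
  | succ m =>
    obtain ⟨f', h1, h2⟩ := hf
    exact ⟨f', fun x hx => (h1 x hx).congr h (h x hx), h2⟩

theorem mono (hf : HolderRec a I m f) (h : J ⊆ I) : HolderRec a J m f := by
  induction m generalizing f with
  | zero =>
    obtain ⟨B, hB, H⟩ := hf
    exact ⟨B, hB, fun x hx y hy => H x (h hx) y (h hy)⟩
  | succ m ih =>
    obtain ⟨f', h1, h2⟩ := hf
    exact ⟨f', fun x hx => (h1 x (h hx)).mono h, ih h2⟩

theorem const (c : ℝ) : HolderRec a I m fun _ => c := by
  induction m generalizing c with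
  | zero => exact ⟨0, le_rfl, fun x _ y _ => by simp⟩
  | succ m ih => exact ⟨fun _ => 0, fun x _ => hasDerivWithinAt_const x I c, ih 0⟩

theorem add (hf : HolderRec a I m f) (hg : HolderRec a I m g) :
    HolderRec a I m fun x => f x + g x := by
  induction m generalizing f g with
  | zero =>
    obtain ⟨A, hA, H⟩ := hf
    obtain ⟨B, hB, K⟩ := hg
    refine ⟨A + B, by positivity, fun x hx y hy => ?_⟩
    have e : f x + g x - (f y + g y) = (f x - f y) + (g x - g y) := by ring
    rw [e, add_mul]
    exact (abs_add_le _ _).trans (add_le_add (H x hx y hy) (K x hx y hy))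
  | succ m ih =>
    obtain ⟨f', h1, h2⟩ := hf
    obtain ⟨g', h3, h4⟩ := hg
    exact ⟨fun x => f' x + g' x, fun x hx => (h1 x hx).add (h3 x hx), ih h2 h4⟩

theorem continuousOn (ha : 0 < a) (hf : HolderRec a I m f) : ContinuousOn f I := by
  cases m with
  | zero =>
    obtain ⟨B, hB, H⟩ := hf
    intro x hx
    rw [ContinuousWithinAt, tendsto_iff_dist_tendsto_zero]
    have h0 : Tendsto (fun y => B * |y - x| ^ a) (𝓝[I] x) (𝓝 0) := by
      have : ContinuousAt (fun y => B * |y - x| ^ a) x :=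
        ((continuous_id.sub continuous_const).abs.continuousAt.rpow_const (Or.inr ha.le)).const_mul B
      have h := this.tendsto
      simp only [sub_self, abs_zero, Real.zero_rpow ha.ne', mul_zero] at h
      exact h.mono_left nhdsWithin_le_nhds
    refine squeeze_zero' (Eventually.of_forall fun _ => dist_nonneg) ?_ h0
    filter_upwards [self_mem_nhdsWithin] with y hy
    exact H y hy x hx
  | succ m =>
    obtain ⟨f', h1, h2⟩ := hf
    exact fun x hx => (h1 x hx).continuousWithinAt

theorem bounded (ha : 0 < a) (hf : HolderRec a (Icc u v) m f) :
    ∃ C, 0 ≤ C ∧ ∀ x ∈ Icc u v, |f x| ≤ C := by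
  obtain ⟨C, hC⟩ := isCompact_Icc.exists_bound_of_continuousOn (hf.continuousOn ha)
  exact ⟨|C|, abs_nonneg _, fun x hx => (hC x hx).trans (le_abs_self C)⟩

theorem zero_of_lipschitz (ha1 : a ≤ 1) {C : ℝ} (hC : 0 ≤ C)
    (hf : ∀ x ∈ Icc u v, ∀ y ∈ Icc u v, |f x - f y| ≤ C * |x - y|) :
    HolderRec a (Icc u v) 0 f := by
  refine ⟨C * |v - u| ^ (1 - a), by positivity, fun x hx y hy => (hf x hx y hy).trans ?_⟩
  rw [mul_assoc]
  refine mul_le_mul_of_nonneg_left ?_ hC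
  rcases eq_or_ne (|x - y|) 0 with h0 | h0
  · rw [h0]; positivity
  · have hp : 0 < |x - y| := lt_of_le_of_ne (abs_nonneg _) h0.symm
    calc |x - y| = |x - y| ^ (1 - a) * |x - y| ^ a := by
          rw [← Real.rpow_add hp]; simp
      _ ≤ |v - u| ^ (1 - a) * |x - y| ^ a := by
          have h1 : |x - y| ≤ |v - u| := by
            rw [abs_of_nonneg (by linarith [hx.1, hx.2] : 0 ≤ v - u), abs_le]
            constructor <;> linarith [hx.1, hx.2, hy.1, hy.2]
          exact mul_le_mul_of_nonneg_right
            (Real.rpow_le_rpow (abs_nonneg _) h1 (by linarith)) (by positivity)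

theorem lipschitz (ha : 0 < a) (hf : HolderRec a (Icc u v) (m + 1) f) :
    ∃ C, 0 ≤ C ∧ ∀ x ∈ Icc u v, ∀ y ∈ Icc u v, |f x - f y| ≤ C * |x - y| := by
  obtain ⟨f', h1, h2⟩ := hf
  obtain ⟨C, hC, h3⟩ := h2.bounded ha
  exact ⟨C, hC, fun x hx y hy =>
    (convex_Icc u v).norm_image_sub_le_of_norm_hasDerivWithin_le h1 h3 hy hx⟩

theorem of_succ (ha : 0 < a) (ha1 : a ≤ 1) (hf : HolderRec a (Icc u v) (m + 1) f) :
    HolderRec a (Icc u v) m f := by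
  induction m generalizing f with
  | zero =>
    obtain ⟨C, hC, h⟩ := hf.lipschitz ha
    exact zero_of_lipschitz ha1 hC h
  | succ m ih =>
    obtain ⟨f', h1, h2⟩ := hf
    exact ⟨f', h1, ih h2⟩

theorem of_le (ha : 0 < a) (ha1 : a ≤ 1) {n : ℕ} (h : n ≤ m) (hf : HolderRec a (Icc u v) m f) :
    HolderRec a (Icc u v) n f := by
  induction m, h using Nat.le_induction with
  | base => exact hf
  | succ m _ ih => exact ih (hf.of_succ ha ha1)

theorem mul (ha : 0 < a) (ha1 : a ≤ 1) (hf : HolderRec a (Icc u v) m f)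
    (hg : HolderRec a (Icc u v) m g) : HolderRec a (Icc u v) m fun x => f x * g x := by
  induction m generalizing f g with
  | zero =>
    obtain ⟨C, hC, hfC⟩ := hf.bounded ha
    obtain ⟨D, hD, hgD⟩ := hg.bounded ha
    obtain ⟨A, hA, H⟩ := hf
    obtain ⟨B, hB, K⟩ := hg
    refine ⟨A * D + C * B, by positivity, fun x hx y hy => ?_⟩
    have e : f x * g x - f y * g y = (f x - f y) * g x + f y * (g x - g y) := by ring
    rw [e]
    refine (abs_add_le _ _).trans ?_
    rw [abs_mul, abs_mul]
    have h1 := mul_le_mul (H x hx y hy) (hgD x hx) (abs_nonneg _) (by positivity)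
    have h2 := mul_le_mul (hfC y hy) (K x hx y hy) (abs_nonneg _) (by positivity)
    linarith
  | succ m ih =>
    have hf0 := hf.of_succ ha ha1
    have hg0 := hg.of_succ ha ha1
    obtain ⟨f', h1, h2⟩ := hf
    obtain ⟨g', h3, h4⟩ := hg
    exact ⟨fun x => f' x * g x + f x * g' x, fun x hx => (h1 x hx).mul (h3 x hx),
      (ih h2 hg0).add (ih hf0 h4)⟩

theorem inv (ha : 0 < a) (ha1 : a ≤ 1) {c : ℝ} (hc : 0 < c) (hf : HolderRec a (Icc u v) m f)
    (hfc : ∀ x ∈ Icc u v, c ≤ |f x|) : HolderRec a (Icc u v) m fun x => (f x)⁻¹ := by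
  have hne : ∀ x ∈ Icc u v, f x ≠ 0 := fun x hx => abs_pos.1 (hc.trans_le (hfc x hx))
  induction m with
  | zero =>
    obtain ⟨A, hA, H⟩ := hf
    refine ⟨A / (c * c), by positivity, fun x hx y hy => ?_⟩
    have e : (f x)⁻¹ - (f y)⁻¹ = (f y - f x) / (f x * f y) := by
      field_simp [hne x hx, hne y hy]
    rw [e, abs_div, abs_mul, abs_sub_comm, div_mul_eq_mul_div]
    exact div_le_div₀ (by positivity) (H x hx y hy) (by positivity)
      (mul_le_mul (hfc x hx) (hfc y hy) hc.le (abs_nonneg _))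
  | succ m ih =>
    have hi := ih (hf.of_succ ha ha1)
    obtain ⟨f', h1, h2⟩ := hf
    refine ⟨fun x => (-1 * f' x) * ((f x)⁻¹ * (f x)⁻¹), fun x hx => ?_,
      ((const (-1)).mul ha ha1 h2).mul ha ha1 (hi.mul ha ha1 hi)⟩
    have e : (-1 * f' x) * ((f x)⁻¹ * (f x)⁻¹) = -f' x / f x ^ 2 := by
      rw [div_eq_mul_inv, sq, mul_inv]
      ring
    simp only [e]
    exact (h1 x hx).inv (hne x hx)

theorem comp {p q : ℝ} {t : ℝ → ℝ} {K : ℝ} (ha : 0 < a) (ha1 : a ≤ 1)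
    (hf : HolderRec a (Icc p q) m f)
    (ht : HolderRec a (Icc u v) m t) (hmaps : MapsTo t (Icc u v) (Icc p q)) (hK : 0 ≤ K)
    (hlip : ∀ x ∈ Icc u v, ∀ y ∈ Icc u v, |t x - t y| ≤ K * |x - y|) :
    HolderRec a (Icc u v) m fun x => f (t x) := by
  induction m generalizing f with
  | zero =>
    obtain ⟨B, hB, H⟩ := hf
    refine ⟨B * K ^ a, by positivity, fun x hx y hy => ?_⟩
    refine (H _ (hmaps hx) _ (hmaps hy)).trans ?_
    rw [mul_assoc, ← Real.mul_rpow hK (abs_nonneg _)]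
    gcongr
    exact hlip x hx y hy
  | succ m ih =>
    have ht0 := ht.of_succ ha ha1
    obtain ⟨f', h1, h2⟩ := hf
    obtain ⟨t', h3, h4⟩ := ht
    exact ⟨fun x => f' (t x) * t' x,
      fun x hx => (h1 _ (hmaps hx)).comp x (h3 x hx) hmaps, (ih h2 ht0).mul ha ha1 h4⟩

/-- A right inverse of a Hölder function with nonvanishing derivative has the same regularity. -/
theorem rightInverse {p q c K : ℝ} {t X X' : ℝ → ℝ} (ha : 0 < a) (ha1 : a ≤ 1)
    (hX : ∀ x ∈ Icc p q, HasDerivWithinAt X (X' x) (Icc p q) x)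
    (hX' : HolderRec a (Icc p q) m X') (hc : 0 < c) (hXc : ∀ x ∈ Icc p q, c ≤ |X' x|)
    (hmaps : MapsTo t (Icc u v) (Icc p q)) (hK : 0 ≤ K)
    (hlip : ∀ x ∈ Icc u v, ∀ y ∈ Icc u v, |t x - t y| ≤ K * |x - y|)
    (hinv : ∀ x ∈ Icc u v, X (t x) = x) : HolderRec a (Icc u v) (m + 1) t := by
  have hcont : ContinuousOn t (Icc u v) := by
    refine (LipschitzOnWith.of_dist_le_mul (K := ⟨K, hK⟩) fun x hx y hy => ?_).continuousOn
    exact hlip x hx y hy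
  have hd : ∀ x ∈ Icc u v, HasDerivWithinAt t (X' (t x))⁻¹ (Icc u v) x := by
    intro x hx
    have hne : X' (t x) ≠ 0 := abs_pos.1 (hc.trans_le (hXc _ (hmaps hx)))
    have h1 : HasFDerivWithinAt X
        (ContinuousLinearEquiv.unitsEquivAut ℝ (Units.mk0 (X' (t x)) hne) : ℝ →L[ℝ] ℝ)
        (Icc p q) (t x) := by
      have e : (ContinuousLinearEquiv.unitsEquivAut ℝ (Units.mk0 (X' (t x)) hne) : ℝ →L[ℝ] ℝ)
          = ContinuousLinearMap.toSpanSingleton ℝ (X' (t x)) := by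
        ext; simp
      rw [e]
      exact (hX _ (hmaps hx)).hasFDerivWithinAt
    have h2 := h1.of_local_left_inverse (g := t) (s := Icc u v) (a := x)
      ((hcont x hx).tendsto_nhdsWithin hmaps) hx
      (by filter_upwards [self_mem_nhdsWithin] with y hy using hinv y hy)
    have h3 := h2.hasDerivWithinAt
    simpa using h3
  have main : ∀ j ≤ m + 1, HolderRec a (Icc u v) j t := by
    intro j
    induction j with
    | zero => exact fun _ => zero_of_lipschitz ha1 hK hlip
    | succ j ih =>
      intro hj
      refine ⟨fun x => (X' (t x))⁻¹, hd, ?_⟩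
      exact ((hX'.of_le ha ha1 (by omega : j ≤ m)).comp ha ha1 (ih (by omega)) hmaps hK hlip).inv
        ha ha1 hc fun x hx => hXc _ (hmaps hx)
  exact main _ le_rfl

theorem of_contDiffOn (huv : u < v) {B : ℝ} (hB : 0 ≤ B) (hf : ContDiffOn ℝ m f (Icc u v))
    (h : ∀ x ∈ Icc u v, ∀ y ∈ Icc u v,
      |iteratedDerivWithin m f (Icc u v) x - iteratedDerivWithin m f (Icc u v) y|
        ≤ B * |x - y| ^ a) : HolderRec a (Icc u v) m f := by
  induction m generalizing f with
  | zero => exact ⟨B, hB, by simpa using h⟩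
  | succ m ih =>
    obtain ⟨h1, -, h2⟩ := (contDiffOn_succ_iff_derivWithin (uniqueDiffOn_Icc huv)).1
      (by exact_mod_cast hf : ContDiffOn ℝ ((m : WithTop ℕ∞) + 1) f (Icc u v))
    refine ⟨derivWithin f (Icc u v), fun x hx => (h1 x hx).hasDerivWithinAt, ih h2 ?_⟩
    intro x hx y hy
    have := h x hx y hy
    rwa [iteratedDerivWithin_succ'] at this

theorem contDiffOn (ha : 0 < a) (huv : u < v) (hf : HolderRec a (Icc u v) m f) :
    ContDiffOn ℝ m f (Icc u v) ∧ (∃ A, 0 ≤ A ∧ ∀ n ≤ m, ∀ x ∈ Icc u v,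
      |iteratedDerivWithin n f (Icc u v) x| ≤ A) ∧
    ∃ B, 0 ≤ B ∧ ∀ x ∈ Icc u v, ∀ y ∈ Icc u v,
      |iteratedDerivWithin m f (Icc u v) x - iteratedDerivWithin m f (Icc u v) y|
        ≤ B * |x - y| ^ a := by
  have hU := uniqueDiffOn_Icc huv
  induction m generalizing f with
  | zero =>
    obtain ⟨C, hC, hfC⟩ := hf.bounded ha
    refine ⟨by simpa using hf.continuousOn ha, ⟨C, hC, ?_⟩, ?_⟩
    · intro n hn x hx
      obtain rfl : n = 0 := by omega
      simpa using hfC x hx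
    · obtain ⟨B, hB, H⟩ := hf
      exact ⟨B, hB, by simpa using H⟩
  | succ m ih =>
    obtain ⟨C, hC, hfC⟩ := hf.bounded ha
    obtain ⟨f', h1, h2⟩ := hf
    have e : ∀ x ∈ Icc u v, derivWithin f (Icc u v) x = f' x :=
      fun x hx => (h1 x hx).derivWithin (hU x hx)
    obtain ⟨i1, ⟨A, hA, i2⟩, B, hB, i3⟩ := ih (h2.congr e)
    refine ⟨?_, ⟨C + A, by positivity, ?_⟩, B, hB, ?_⟩
    · have := (contDiffOn_succ_iff_derivWithin (n := (m : WithTop ℕ∞)) hU).2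
        ⟨fun x hx => (h1 x hx).differentiableWithinAt, by simp, i1⟩
      exact_mod_cast this
    · intro n hn x hx
      cases n with
      | zero => simpa using (hfC x hx).trans (by linarith)
      | succ n =>
        rw [iteratedDerivWithin_succ']
        exact (i2 n (by omega) x hx).trans (by linarith)
    · intro x hx y hy
      rw [iteratedDerivWithin_succ']
      exact i3 x hx y hy

theorem holderClass {s : ℝ} (hs : 0 < s - holderOrder s) (huv : u < v)
    (hf : HolderRec (s - holderOrder s) (Icc u v) (holderOrder s) f) :
    HolderClass s (Icc u v) f := by
  obtain ⟨h1, ⟨A, hA, h2⟩, B, hB, h3⟩ := hf.contDiffOn hs huv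
  exact ⟨A + B, h1, A, B, hA, hB, le_rfl, h2, h3⟩

end HolderRec

theorem HolderNormLE.holderRec {s u v M : ℝ} {f : ℝ → ℝ} (huv : u < v)
    (hf : HolderNormLE s (Icc u v) f M) :
    HolderRec (s - holderOrder s) (Icc u v) (holderOrder s) f := by
  obtain ⟨h1, A, B, -, hB, -, -, h3⟩ := hf
  exact HolderRec.of_contDiffOn huv hB h1 h3

theorem holderOrder_pos {s : ℝ} (hs : 1 < s) : 1 ≤ holderOrder s := by
  have : 1 < ⌈s⌉₊ := Nat.lt_ceil.2 (by simpa using hs)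
  unfold holderOrder
  omega

theorem holderOrder_lt {s : ℝ} (hs : 1 < s) : 0 < s - holderOrder s := by
  have h1 : 1 < ⌈s⌉₊ := Nat.lt_ceil.2 (by simpa using hs)
  have h2 := Nat.ceil_lt_add_one (by linarith : 0 ≤ s)
  unfold holderOrder
  rw [Nat.cast_sub h1.le]
  push_cast
  linarith

theorem sub_holderOrder_le {s : ℝ} (hs : 1 < s) : s - holderOrder s ≤ 1 := by
  have h1 : 1 < ⌈s⌉₊ := Nat.lt_ceil.2 (by simpa using hs)
  have h2 := Nat.le_ceil s
  unfold holderOrder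
  rw [Nat.cast_sub h1.le]
  push_cast
  linarith

/-- Near the origin, the functions of `C^s` norm at most `M` are uniformly close in `C¹` to linear
functions. -/
theorem exists_radius_derivWithin_near {s R M η : ℝ} (hs : 1 < s) (hR : 0 < R) (hM : 0 < M)
    (hη : 0 < η) :
    ∃ r, 0 < r ∧ r ≤ R ∧ ∀ ψ : ℝ → ℝ, HolderNormLE s (Icc (-R) R) ψ M →
      ∃ (p : ℝ) (g : ℝ → ℝ), |p| ≤ M ∧
        (∀ t ∈ Icc (-r) r, HasDerivWithinAt ψ (g t) (Icc (-r) r) t) ∧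
        (∀ t ∈ Icc (-r) r, |g t - p| ≤ η) ∧
        ∃ m, holderOrder s = m + 1 ∧ HolderRec (s - holderOrder s) (Icc (-r) r) m g := by
  obtain ⟨m, hm⟩ := Nat.exists_eq_add_of_le' (holderOrder_pos hs)
  have ha := holderOrder_lt hs
  have ha1 := sub_holderOrder_le hs
  set a := s - holderOrder s with ha_def
  obtain ⟨r, hr0, hr1, hrR, hr⟩ : ∃ r, 0 < r ∧ r ≤ 1 ∧ r ≤ R ∧ M * r ^ a ≤ η := by
    refine ⟨min (min 1 R) ((η / M) ^ a⁻¹), by positivity, (min_le_left _ _).trans (min_le_left _ _),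
      (min_le_left _ _).trans (min_le_right _ _), ?_⟩
    have h : min (min 1 R) ((η / M) ^ a⁻¹) ^ a ≤ ((η / M) ^ a⁻¹) ^ a := by
      gcongr
      exact min_le_right _ _
    rw [Real.rpow_inv_rpow (by positivity) ha.ne'] at h
    calc M * _ ≤ M * (η / M) := by gcongr
      _ = η := by field_simp
  refine ⟨r, hr0, hrR, fun ψ hψ => ?_⟩
  have hRR : -R < R := by linarith
  have hU := uniqueDiffOn_Icc hRR
  have hsub : Icc (-r) r ⊆ Icc (-R) R := Icc_subset_Icc (by linarith) hrR
  have h0 : (0 : ℝ) ∈ Icc (-R) R := ⟨by linarith, hR.le⟩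
  obtain ⟨h1, A, B, hA, hB, hAB, h2, h3⟩ := hψ
  rw [hm] at h1 h3
  obtain ⟨d1, -, d2⟩ := (contDiffOn_succ_iff_derivWithin hU).1
      (by exact_mod_cast h1 : ContDiffOn ℝ ((m : WithTop ℕ∞) + 1) ψ (Icc (-R) R))
  have hb : |derivWithin ψ (Icc (-R) R) 0| ≤ M := by
    have := h2 1 (by omega) 0 h0
    rw [iteratedDerivWithin_one] at this
    linarith
  refine ⟨derivWithin ψ (Icc (-R) R) 0, derivWithin ψ (Icc (-R) R), hb, fun t ht =>
    ((d1 t (hsub ht)).hasDerivWithinAt).mono hsub, fun t ht => ?_, m, hm, ?_⟩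
  · have htr : |t| ≤ r := abs_le.2 ht
    have hpow : |t| ≤ r ^ a := htr.trans (by
      calc r = r ^ (1 : ℝ) := (Real.rpow_one r).symm
        _ ≤ r ^ a := Real.rpow_le_rpow_of_exponent_ge hr0 hr1 ha1)
    cases m with
    | zero =>
      have := h3 t (hsub ht) 0 h0
      rw [zero_add, iteratedDerivWithin_one] at this
      have e : s - ((0 + 1 : ℕ) : ℝ) = a := by rw [ha_def, hm]
      rw [e, sub_zero] at this
      calc _ ≤ B * |t| ^ a := this
        _ ≤ M * r ^ a := by
          gcongr
          linarith
        _ ≤ η := hr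
    | succ n =>
      obtain ⟨d3, -, -⟩ := (contDiffOn_succ_iff_derivWithin (n := (n : WithTop ℕ∞)) hU).1
        (by exact_mod_cast d2)
      have := (convex_Icc (-R) R).norm_image_sub_le_of_norm_hasDerivWithin_le (C := A)
        (fun x hx => (d3 x hx).hasDerivWithinAt) (fun x hx => ?_) h0 (hsub ht)
      · rw [sub_zero, Real.norm_eq_abs, Real.norm_eq_abs] at this
        calc _ ≤ A * |t| := this
          _ ≤ M * r ^ a := by
            gcongr
            linarith
          _ ≤ η := hr
      · have := h2 2 (by omega) x hx
        rwa [show (2 : ℕ) = 1 + 1 from rfl, iteratedDerivWithin_succ', iteratedDerivWithin_one]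
          at this
  · refine (HolderRec.of_contDiffOn hRR hB d2 fun x hx y hy => ?_).mono hsub
    have := h3 x hx y hy
    rw [iteratedDerivWithin_succ'] at this
    rwa [ha_def, hm]

/-- The affine form `z ↦ n · (z - z₀)`. -/
def normalForm (n z₀ z : ℝ × ℝ) : ℝ := n.1 * (z.1 - z₀.1) + n.2 * (z.2 - z₀.2)

theorem measurableSet_meshCell (h : ℝ) (i j : ℤ) : MeasurableSet (meshCell h i j) :=
  measurableSet_Icc.prod measurableSet_Icc

theorem volume_real_meshCell {h : ℝ} (hh : 0 < h) (i j : ℤ) :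
    volume.real (meshCell h i j) = h * h := by
  rw [meshCell, Measure.volume_eq_prod, measureReal_prod_prod, Real.volume_real_Icc_of_le,
    Real.volume_real_Icc_of_le]
  · ring
  all_goals linarith

theorem volume_meshCell_ne_top (h : ℝ) (i j : ℤ) : volume (meshCell h i j) ≠ ⊤ :=
  (isCompact_Icc.prod isCompact_Icc).measure_lt_top.ne

theorem cellAverage_eq {Ω : Set (ℝ × ℝ)} (hΩ : MeasurableSet Ω) {h : ℝ} (hh : 0 < h) (i j : ℤ) :
    cellAverage Ω h i j = volume.real (meshCell h i j ∩ Ω) / (h * h) := by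
  have e := integral_indicator_one (μ := volume.restrict (meshCell h i j)) hΩ
  rw [measureReal_restrict_apply hΩ, inter_comm] at e
  rw [cellAverage, setAverage_eq, volume_real_meshCell hh, smul_eq_mul, ← e, div_eq_inv_mul]
  rfl

theorem measurePreserving_diagonalReflection (d : ℝ) :
    MeasurePreserving (fun z : ℝ × ℝ => (z.2 + d, z.1 - d)) volume volume := by
  have h1 := (measurePreserving_add_right (volume : Measure ℝ) d).prod
    (measurePreserving_add_right (volume : Measure ℝ) (-d))
  have h2 := h1.comp (Measure.measurePreserving_swap (μ := (volume : Measure ℝ))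
    (ν := (volume : Measure ℝ)))
  exact h2

theorem measurePreserving_swap_plane :
    MeasurePreserving (Prod.swap : ℝ × ℝ → ℝ × ℝ) volume volume :=
  Measure.measurePreserving_swap (μ := (volume : Measure ℝ)) (ν := (volume : Measure ℝ))

theorem measurePreserving_conj :
    MeasurePreserving (fun z : ℝ × ℝ => (z.1, -z.2)) volume volume :=
  (MeasurePreserving.id (volume : Measure ℝ)).prod (Measure.measurePreserving_neg volume)

theorem volume_strip_le {n z₀ : ℝ × ℝ} {u b h c w : ℝ} (hh : 0 ≤ h) (hc : 0 < c) (hw : 0 ≤ w)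
    (hn : c ≤ |n.1| ∨ c ≤ |n.2|) :
    volume.real ((Icc u (u + h) ×ˢ Icc b (b + h)) ∩ {z | |normalForm n z₀ z| ≤ w}) ≤
      h * (2 * w / c) := by
  set S := (Icc u (u + h) ×ˢ Icc b (b + h)) ∩ {z | |normalForm n z₀ z| ≤ w} with hS
  have hSm : MeasurableSet S := by
    refine (measurableSet_Icc.prod measurableSet_Icc).inter ?_
    refine measurableSet_le ?_ measurable_const
    unfold normalForm
    fun_prop
  have key : ∀ α β : ℝ, c ≤ |α| →
      volume {t : ℝ | |α * t + β| ≤ w} ≤ ENNReal.ofReal (2 * w / c) := by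
    intro α β hα
    have hα0 : 0 < |α| := hc.trans_le hα
    have hα1 : α ≠ 0 := abs_pos.1 hα0
    have : {t : ℝ | |α * t + β| ≤ w} ⊆ Icc (-β / α - w / c) (-β / α + w / c) := by
      intro t ht
      have e : t - -β / α = (α * t + β) / α := by field_simp; ring
      have h1 : |t - -β / α| ≤ w / c := by
        rw [e, abs_div]
        exact div_le_div₀ hw ht hc hα
      rw [abs_le] at h1
      constructor <;> linarith
    refine (measure_mono this).trans ?_
    rw [Real.volume_Icc]
    apply ENNReal.ofReal_le_ofReal
    have : 2 * w / c = w / c + w / c := by ring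
    linarith
  have hle : volume S ≤ ENNReal.ofReal (h * (2 * w / c)) := by
    rw [ENNReal.ofReal_mul hh, mul_comm]
    rcases hn with hn | hn
    · rw [Measure.volume_eq_prod, Measure.prod_apply_symm hSm]
      calc ∫⁻ y, volume ((fun x => (x, y)) ⁻¹' S)
          ≤ ∫⁻ y, (Icc b (b + h)).indicator (fun _ => ENNReal.ofReal (2 * w / c)) y := by
            refine lintegral_mono fun y => ?_
            by_cases hy : y ∈ Icc b (b + h)
            · rw [indicator_of_mem hy]
              refine le_trans (measure_mono fun x hx => ?_)
                (key n.1 (n.2 * (y - z₀.2) - n.1 * z₀.1) hn)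
              have := hx.2
              simp only [mem_ofPred_eq, normalForm] at this ⊢
              convert this using 2
              ring
            · have : (fun x => (x, y)) ⁻¹' S = ∅ := by
                ext x
                simp only [mem_preimage, mem_empty_iff_false, iff_false]
                exact fun hx => hy hx.1.2
              rw [this]
              simp
        _ = _ := by
            rw [lintegral_indicator measurableSet_Icc, setLIntegral_const, Real.volume_Icc]
            simp
    · rw [Measure.volume_eq_prod, Measure.prod_apply hSm]
      calc ∫⁻ x, volume (Prod.mk x ⁻¹' S)
          ≤ ∫⁻ x, (Icc u (u + h)).indicator (fun _ => ENNReal.ofReal (2 * w / c)) x := by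
            refine lintegral_mono fun x => ?_
            by_cases hx : x ∈ Icc u (u + h)
            · rw [indicator_of_mem hx]
              refine le_trans (measure_mono fun y hy => ?_)
                (key n.2 (n.1 * (x - z₀.1) - n.2 * z₀.2) hn)
              have := hy.2
              simp only [mem_ofPred_eq, normalForm] at this ⊢
              convert this using 2
              ring
            · have : Prod.mk x ⁻¹' S = ∅ := by
                ext y
                simp only [mem_preimage, mem_empty_iff_false, iff_false]
                exact fun hy => hx hy.1.1
              rw [this]
              simp
        _ = _ := by
            rw [lintegral_indicator measurableSet_Icc, setLIntegral_const, Real.volume_Icc]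
            simp
  exact ENNReal.toReal_le_of_le_ofReal (by positivity) hle

/-- In the square of half-side `2 h` around `z₀`, the set `Ω` is a half-plane of outer normal `n`
up to an error `ε h`. -/
def NearHalfPlane (Ω : Set (ℝ × ℝ)) (n z₀ : ℝ × ℝ) (h ε : ℝ) : Prop :=
  ∀ z : ℝ × ℝ, |z.1 - z₀.1| ≤ 2 * h → |z.2 - z₀.2| ≤ 2 * h →
    (z ∈ Ω → normalForm n z₀ z ≤ ε * h) ∧ (z ∉ Ω → -(ε * h) ≤ normalForm n z₀ z)

section Sobel

variable {Ω : Set (ℝ × ℝ)} {n z₀ : ℝ × ℝ} {h ε δ K : ℝ} {i j : ℤ}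

theorem abs_sub_le_of_mem_meshCell (hz₀ : z₀ ∈ meshCell h i j) {a b : ℤ} (hh : 0 < h)
    (ha : |a| ≤ 1) (hb : |b| ≤ 1) {z : ℝ × ℝ} (hz : z ∈ meshCell h (i + a) (j + b)) :
    |z.1 - z₀.1| ≤ 2 * h ∧ |z.2 - z₀.2| ≤ 2 * h := by
  obtain ⟨⟨h1, h2⟩, h3, h4⟩ := hz₀
  obtain ⟨⟨h5, h6⟩, h7, h8⟩ := hz
  rw [abs_le] at ha hb
  have a1 : (-1 : ℝ) ≤ a := by exact_mod_cast ha.1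
  have a2 : (a : ℝ) ≤ 1 := by exact_mod_cast ha.2
  have b1 : (-1 : ℝ) ≤ b := by exact_mod_cast hb.1
  have b2 : (b : ℝ) ≤ 1 := by exact_mod_cast hb.2
  push_cast at h5 h6 h7 h8
  rw [abs_le, abs_le]
  refine ⟨⟨?_, ?_⟩, ?_, ?_⟩ <;> nlinarith

/-- Comparison of the areas of `Ω` in a cell below the diagonal of the central cell and in its
mirror image: the former is smaller, up to the area of a thin strip, with a gain given by the
set `G` that lies outside `Ω` and is reflected into it. -/
theorem volume_inter_meshCell_add_le (hΩ : MeasurableSet Ω) (hh : 0 < h)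
    (hz₀ : z₀ ∈ meshCell h i j) (hδ : 0 < δ) (hε : 0 ≤ ε) (hn : δ ≤ n.1 - n.2)
    (hH : NearHalfPlane Ω n z₀ h ε) {a b : ℤ} (ha : |a| ≤ 1) (hb : |b| ≤ 1) (hab : b < a)
    {G : Set (ℝ × ℝ)} (hGm : MeasurableSet G) (hGQ : G ⊆ meshCell h (i + a) (j + b))
    (hG : ∀ z ∈ G, z ∉ Ω ∧ (z.2 + (i - j) * h, z.1 - (i - j) * h) ∈ Ω) :
    volume.real (meshCell h (i + a) (j + b) ∩ Ω) + volume.real G ≤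
      volume.real (meshCell h (i + b) (j + a) ∩ Ω) + 4 * ε / δ * (h * h) := by
  set Q := meshCell h (i + a) (j + b) with hQ
  set σ : ℝ × ℝ → ℝ × ℝ := fun z => (z.2 + (i - j) * h, z.1 - (i - j) * h) with hσ
  have hσp : MeasurePreserving σ volume volume := measurePreserving_diagonalReflection _
  have hσQ : σ ⁻¹' (meshCell h (i + b) (j + a)) = Q := by
    ext z
    simp only [hσ, hQ, meshCell, mem_preimage, mem_prod, mem_Icc]
    push_cast
    constructor
    · rintro ⟨⟨h1, h2⟩, h3, h4⟩
      refine ⟨⟨?_, ?_⟩, ?_, ?_⟩ <;> linarith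
    · rintro ⟨⟨h1, h2⟩, h3, h4⟩
      refine ⟨⟨?_, ?_⟩, ?_, ?_⟩ <;> linarith
  have hab' : (b : ℝ) + 1 ≤ a := by exact_mod_cast hab
  set S := Q ∩ {z | |normalForm n z₀ z| ≤ ε * h} with hS
  have hsub : Q ∩ Ω ∪ G ⊆ σ ⁻¹' (meshCell h (i + b) (j + a) ∩ Ω) ∪ S := by
    rintro z (⟨hzQ, hzΩ⟩ | hz)
    · by_cases hz' : σ z ∈ Ω
      · left
        rw [preimage_inter, hσQ]
        exact ⟨hzQ, hz'⟩
      · right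
        refine ⟨hzQ, ?_⟩
        have hσz : σ z ∈ meshCell h (i + b) (j + a) := by
          rw [← mem_preimage, hσQ]; exact hzQ
        obtain ⟨e1, e2⟩ := abs_sub_le_of_mem_meshCell hz₀ hh ha hb hzQ
        obtain ⟨e3, e4⟩ := abs_sub_le_of_mem_meshCell hz₀ hh hb ha hσz
        have u1 := (hH z e1 e2).1 hzΩ
        have u2 := (hH (σ z) e3 e4).2 hz'
        have u3 : normalForm n z₀ z - normalForm n z₀ (σ z) =
            (n.1 - n.2) * (z.1 - z.2 - (i - j) * h) := by
          simp only [normalForm, hσ]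
          ring
        have u4 : 0 ≤ z.1 - z.2 - (i - j) * h := by
          obtain ⟨⟨h1, h2⟩, h3, h4⟩ := hzQ
          push_cast at h1 h2 h3 h4
          nlinarith
        have u5 := mul_nonneg (hδ.le.trans hn) u4
        exact abs_le.2 ⟨by linarith, u1⟩
    · left
      rw [preimage_inter, hσQ]
      exact ⟨hGQ hz, (hG z hz).2⟩
  have hfin : ∀ a b : ℤ, ∀ A : Set (ℝ × ℝ), volume (meshCell h a b ∩ A) ≠ ⊤ := fun a b A =>
    measure_ne_top_of_subset inter_subset_left (volume_meshCell_ne_top h a b)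
  have hdisj : Disjoint (Q ∩ Ω) G :=
    Set.disjoint_left.2 fun z hz hzG => (hG z hzG).1 hz.2
  have hpre : volume.real (σ ⁻¹' (meshCell h (i + b) (j + a) ∩ Ω)) =
      volume.real (meshCell h (i + b) (j + a) ∩ Ω) := by
    rw [measureReal_def, measureReal_def,
      hσp.measure_preimage ((measurableSet_meshCell _ _ _).inter hΩ).nullMeasurableSet]
  have hpre_top : volume (σ ⁻¹' (meshCell h (i + b) (j + a) ∩ Ω)) ≠ ⊤ := by
    rw [hσp.measure_preimage ((measurableSet_meshCell _ _ _).inter hΩ).nullMeasurableSet]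
    exact hfin _ _ _
  have hstrip : volume.real S ≤ 4 * ε / δ * (h * h) := by
    have hc : δ / 2 ≤ |n.1| ∨ δ / 2 ≤ |n.2| := by
      by_contra! hcon
      have := abs_lt.1 hcon.1
      have := abs_lt.1 hcon.2
      linarith
    have h1 := volume_strip_le (z₀ := z₀) (u := ((i + a : ℤ) : ℝ) * h) (b := ((j + b : ℤ) : ℝ) * h)
      hh.le (half_pos hδ) (mul_nonneg hε hh.le) hc
    have e : (Icc (((i + a : ℤ) : ℝ) * h) (((i + a : ℤ) : ℝ) * h + h) ×ˢ
        Icc (((j + b : ℤ) : ℝ) * h) (((j + b : ℤ) : ℝ) * h + h)) = Q := by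
      simp only [hQ, meshCell, add_mul, one_mul]
    rw [e] at h1
    calc _ ≤ _ := h1
      _ = _ := by field_simp; ring
  calc volume.real (Q ∩ Ω) + volume.real G = volume.real (Q ∩ Ω ∪ G) :=
        (measureReal_union hdisj hGm (hfin _ _ _)
          (measure_ne_top_of_subset hGQ (volume_meshCell_ne_top _ _ _))).symm
    _ ≤ volume.real (σ ⁻¹' (meshCell h (i + b) (j + a) ∩ Ω) ∪ S) :=
        measureReal_mono hsub (measure_union_ne_top hpre_top (hfin _ _ _))
    _ ≤ volume.real (σ ⁻¹' (meshCell h (i + b) (j + a) ∩ Ω)) + volume.real S :=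
        measureReal_union_le _ _
    _ ≤ _ := by rw [hpre]; linarith

/-- A box of side `ρ h` outside `Ω` whose mirror image is inside `Ω`. -/
theorem exists_box_reflected (hh : 0 < h) (hz₀ : z₀ ∈ meshCell h i j) (hδ : 0 < δ)
    (hn : δ ≤ n.1 - n.2) (hK : |n.1| + |n.2| ≤ K) (hεδ : ε < δ / 8)
    (hH : NearHalfPlane Ω n z₀ h ε) :
    ∃ w : ℝ × ℝ, ∃ a b : ℤ, ((a = 1 ∧ b = 0) ∨ (a = 0 ∧ b = -1) ∨ (a = 1 ∧ b = -1)) ∧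
      ∀ z : ℝ × ℝ, |z.1 - w.1| ≤ δ / (16 * K) * h → |z.2 - w.2| ≤ δ / (16 * K) * h →
        z ∈ meshCell h (i + a) (j + b) ∧ z ∉ Ω ∧
          (z.2 + (i - j) * h, z.1 - (i - j) * h) ∈ Ω := by
  have hn1 := abs_le.1 (le_refl |n.1|)
  have hn2 := abs_le.1 (le_refl |n.2|)
  have hδK : δ ≤ K := by linarith
  have hK0 : 0 < K := hδ.trans_le hδK
  set ρ := δ / (16 * K) with hρ
  have hρ0 : 0 < ρ := by positivity
  have hρK : ρ * K = δ / 16 := by rw [hρ]; field_simp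
  have hρ1 : ρ ≤ 1 / 16 := by
    rw [hρ, div_le_div_iff₀ (by positivity) (by norm_num)]; linarith
  have hρh : ρ * h ≤ h / 16 := by nlinarith
  set p₀ := (z₀.1 - (i + 1 / 2) * h) - (z₀.2 - (j + 1 / 2) * h) with hp₀
  set q₀ := (z₀.1 - (i + 1 / 2) * h) + (z₀.2 - (j + 1 / 2) * h) with hq₀
  obtain ⟨⟨c1, c2⟩, c3, c4⟩ := id hz₀
  have key : ∀ (p : ℝ) (a b : ℤ), |a| ≤ 1 → |b| ≤ 1 → |p₀| + h / 2 ≤ p →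
      (∀ z : ℝ × ℝ, |z.1 - ((i + 1 / 2) * h + (q₀ + p) / 2)| ≤ ρ * h →
        |z.2 - ((j + 1 / 2) * h + (q₀ - p) / 2)| ≤ ρ * h → z ∈ meshCell h (i + a) (j + b)) →
      ∀ z : ℝ × ℝ, |z.1 - ((i + 1 / 2) * h + (q₀ + p) / 2)| ≤ ρ * h →
        |z.2 - ((j + 1 / 2) * h + (q₀ - p) / 2)| ≤ ρ * h →
        z ∈ meshCell h (i + a) (j + b) ∧ z ∉ Ω ∧
          (z.2 + (i - j) * h, z.1 - (i - j) * h) ∈ Ω := by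
    intro p a b ha hb hp hcell z hz1 hz2
    have hzc := hcell z hz1 hz2
    have hσc : ((z.2 + (i - j) * h, z.1 - (i - j) * h) : ℝ × ℝ) ∈ meshCell h (i + b) (j + a) := by
      obtain ⟨⟨h1, h2⟩, h3, h4⟩ := hzc
      push_cast at h1 h2 h3 h4
      refine ⟨⟨?_, ?_⟩, ?_, ?_⟩ <;> push_cast <;> linarith
    obtain ⟨e1, e2⟩ := abs_sub_le_of_mem_meshCell hz₀ hh ha hb hzc
    obtain ⟨e3, e4⟩ := abs_sub_le_of_mem_meshCell hz₀ hh hb ha hσc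
    set P := (z.1 - (i + 1 / 2) * h) - (z.2 - (j + 1 / 2) * h) with hP
    set T := (z.1 - (i + 1 / 2) * h) + (z.2 - (j + 1 / 2) * h) with hT
    rw [abs_le] at hz1 hz2
    have f1 : normalForm n z₀ z = ((n.1 - n.2) * (P - p₀) + (n.1 + n.2) * (T - q₀)) / 2 := by
      simp only [normalForm, hP, hT, hp₀, hq₀]; ring
    have f2 : normalForm n z₀ (z.2 + (i - j) * h, z.1 - (i - j) * h) =
        (-((n.1 - n.2) * (P + p₀)) + (n.1 + n.2) * (T - q₀)) / 2 := by
      simp only [normalForm, hP, hT, hp₀, hq₀]; ring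
    have g1 : |(n.1 + n.2) * (T - q₀)| ≤ K * (2 * (ρ * h)) := by
      rw [abs_mul]
      refine mul_le_mul ((abs_add_le _ _).trans hK) ?_ (abs_nonneg _) hK0.le
      rw [abs_le]
      constructor <;> linarith
    have g2 : K * (2 * (ρ * h)) = δ / 8 * h := by
      rw [show K * (2 * (ρ * h)) = 2 * (ρ * K) * h by ring, hρK]; ring
    rw [g2, abs_le] at g1
    have hp0 := abs_le.1 (le_refl |p₀|)
    have q1 : 3 * h / 8 ≤ P - p₀ := by linarith
    have q2 : 3 * h / 8 ≤ P + p₀ := by linarith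
    have r1 : δ * (3 * h / 8) ≤ (n.1 - n.2) * (P - p₀) :=
      mul_le_mul hn q1 (by positivity) (by linarith)
    have r2 : δ * (3 * h / 8) ≤ (n.1 - n.2) * (P + p₀) :=
      mul_le_mul hn q2 (by positivity) (by linarith)
    have hεh : ε * h < δ / 8 * h := mul_lt_mul_of_pos_right hεδ hh
    refine ⟨hzc, fun hz => ?_, ?_⟩
    · have := (hH z e1 e2).1 hz
      rw [f1] at this
      linarith
    · by_contra hz
      have := (hH _ e3 e4).2 hz
      rw [f2] at this
      linarith
  rcases le_total (h / 2) |q₀| with hq | hq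
  · have hp : |p₀| + h / 2 ≤ h := by
      have : |p₀| ≤ h / 2 := by
        rcases le_abs.1 hq with hq | hq <;> rw [abs_le] <;> constructor <;> linarith
      linarith
    rcases le_abs.1 hq with hq | hq
    · refine ⟨((i + 1 / 2) * h + (q₀ + h) / 2, (j + 1 / 2) * h + (q₀ - h) / 2), 1, 0,
        Or.inl ⟨rfl, rfl⟩, key h 1 0 (by simp) (by simp) hp ?_⟩
      intro z hz1 hz2
      rw [abs_le] at hz1 hz2
      refine ⟨⟨?_, ?_⟩, ?_, ?_⟩ <;> push_cast <;> linarith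
    · refine ⟨((i + 1 / 2) * h + (q₀ + h) / 2, (j + 1 / 2) * h + (q₀ - h) / 2), 0, -1,
        Or.inr (Or.inl ⟨rfl, rfl⟩), key h 0 (-1) (by simp) (by simp) hp ?_⟩
      intro z hz1 hz2
      rw [abs_le] at hz1 hz2
      refine ⟨⟨?_, ?_⟩, ?_, ?_⟩ <;> push_cast <;> linarith
  · have hp : |p₀| + h / 2 ≤ 2 * h := by
      have : |p₀| ≤ h := by
        rw [abs_le]; constructor <;> linarith
      linarith
    refine ⟨((i + 1 / 2) * h + (q₀ + 2 * h) / 2, (j + 1 / 2) * h + (q₀ - 2 * h) / 2), 1, -1,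
      Or.inr (Or.inr ⟨rfl, rfl⟩), key (2 * h) 1 (-1) (by simp) (by simp) hp ?_⟩
    intro z hz1 hz2
    rw [abs_le] at hz1 hz2 hq
    refine ⟨⟨?_, ?_⟩, ?_, ?_⟩ <;> push_cast <;> linarith

theorem sobelH_lt_sobelV (hΩ : MeasurableSet Ω) (hh : 0 < h) (hz₀ : z₀ ∈ meshCell h i j)
    (hδ : 0 < δ) (hε : 0 ≤ ε) (hK : |n.1| + |n.2| ≤ K) (hn : δ ≤ n.1 - n.2)
    (hsmall : 1000 * K ^ 2 * ε < δ ^ 3) (hH : NearHalfPlane Ω n z₀ h ε) :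
    sobelH Ω h i j < sobelV Ω h i j := by
  have hn1 := abs_le.1 (le_refl |n.1|)
  have hn2 := abs_le.1 (le_refl |n.2|)
  have hδK : δ ≤ K := by linarith
  have hK0 : 0 < K := hδ.trans_le hδK
  have hεδ : ε < δ / 8 := by
    by_contra! hcon
    have h1 : δ ^ 2 ≤ K ^ 2 := by gcongr
    have h2 : δ ^ 2 * (δ / 8) ≤ K ^ 2 * ε := mul_le_mul h1 hcon (by positivity) (by positivity)
    nlinarith [pow_pos hδ 3]
  obtain ⟨w, a, b, hab, hw⟩ := exists_box_reflected hh hz₀ hδ hn hK hεδ hH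
  set ρ := δ / (16 * K) with hρ
  have hρ0 : 0 < ρ := by positivity
  set G : Set (ℝ × ℝ) := Icc (w.1 - ρ * h) (w.1 + ρ * h) ×ˢ Icc (w.2 - ρ * h) (w.2 + ρ * h) with hG
  have hGm : MeasurableSet G := measurableSet_Icc.prod measurableSet_Icc
  have hGv : volume.real G = 4 * ρ ^ 2 * (h * h) := by
    have : 0 ≤ ρ * h := by positivity
    rw [hG, Measure.volume_eq_prod, measureReal_prod_prod, Real.volume_real_Icc_of_le (by linarith),
      Real.volume_real_Icc_of_le (by linarith)]
    ring
  have hGw : ∀ z ∈ G, z ∈ meshCell h (i + a) (j + b) ∧ z ∉ Ω ∧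
      (z.2 + (i - j) * h, z.1 - (i - j) * h) ∈ Ω := by
    rintro z ⟨⟨h1, h2⟩, h3, h4⟩
    refine hw z ?_ ?_ <;> rw [abs_le] <;> constructor <;> linarith
  have base : ∀ {a b : ℤ}, |a| ≤ 1 → |b| ≤ 1 → b < a →
      volume.real (meshCell h (i + a) (j + b) ∩ Ω) ≤
        volume.real (meshCell h (i + b) (j + a) ∩ Ω) + 4 * ε / δ * (h * h) := by
    intro a b ha hb hab
    have := volume_inter_meshCell_add_le hΩ hh hz₀ hδ hε hn hH ha hb hab MeasurableSet.empty
      (empty_subset _) (fun z hz => hz.elim)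
    simpa using this
  have gain : |a| ≤ 1 → |b| ≤ 1 → b < a →
      volume.real (meshCell h (i + a) (j + b) ∩ Ω) + 4 * ρ ^ 2 * (h * h) ≤
        volume.real (meshCell h (i + b) (j + a) ∩ Ω) + 4 * ε / δ * (h * h) := by
    intro ha hb hab
    rw [← hGv]
    exact volume_inter_meshCell_add_le hΩ hh hz₀ hδ hε hn hH ha hb hab hGm
      (fun z hz => (hGw z hz).1) (fun z hz => (hGw z hz).2)
  have hpos : 3 * (4 * ε / δ) * (h * h) < 4 * ρ ^ 2 * (h * h) := by
    refine mul_lt_mul_of_pos_right ?_ (by positivity)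
    have e1 : 3 * (4 * ε / δ) = 12 * ε / δ := by ring
    have e2 : 4 * ρ ^ 2 = δ ^ 2 / (64 * K ^ 2) := by rw [hρ]; field_simp; ring
    rw [e1, e2, div_lt_div_iff₀ hδ (by positivity)]
    have : 0 ≤ K ^ 2 * ε := by positivity
    nlinarith
  have b1 := base (a := 1) (b := 0) (by simp) (by simp) (by simp)
  have b2 := base (a := 0) (b := -1) (by simp) (by simp) (by simp)
  have b3 := base (a := 1) (b := -1) (by simp) (by simp) (by simp)
  simp only [add_zero, ← sub_eq_add_neg] at b1 b2 b3
  have hsum : volume.real (meshCell h (i + 1) j ∩ Ω) + volume.real (meshCell h i (j - 1) ∩ Ω) +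
      volume.real (meshCell h (i + 1) (j - 1) ∩ Ω) <
      volume.real (meshCell h i (j + 1) ∩ Ω) + volume.real (meshCell h (i - 1) j ∩ Ω) +
      volume.real (meshCell h (i - 1) (j + 1) ∩ Ω) := by
    rcases hab with ⟨rfl, rfl⟩ | ⟨rfl, rfl⟩ | ⟨rfl, rfl⟩
    all_goals
      have g := gain (by simp) (by simp) (by simp)
      simp only [add_zero, ← sub_eq_add_neg] at g
      linarith
  have hdiv := div_lt_div_of_pos_right hsum (mul_pos hh hh)
  simp only [add_div, ← cellAverage_eq hΩ hh] at hdiv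
  unfold sobelH sobelV
  linarith

end Sobel

/-- Reflection of the plane in the first axis. -/
def conjPlane (z : ℝ × ℝ) : ℝ × ℝ := (z.1, -z.2)

section Symmetry

variable {Ω : Set (ℝ × ℝ)} {s h ε : ℝ} {n z₀ : ℝ × ℝ} {i j : ℤ}

theorem conjPlane_involutive : Function.Involutive conjPlane := fun z => by simp [conjPlane]

theorem continuous_conjPlane : Continuous conjPlane := by unfold conjPlane; fun_prop

theorem preimage_conjPlane_meshCell (h : ℝ) (i j : ℤ) :
    conjPlane ⁻¹' meshCell h i (-j - 1) = meshCell h i j := by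
  ext z
  simp only [conjPlane, meshCell, mem_preimage, mem_prod, mem_Icc]
  push_cast
  constructor
  · rintro ⟨h1, h2, h3⟩
    exact ⟨h1, by linarith, by linarith⟩
  · rintro ⟨h1, h2, h3⟩
    exact ⟨h1, by linarith, by linarith⟩

theorem preimage_swap_meshCell (h : ℝ) (i j : ℤ) :
    Prod.swap ⁻¹' meshCell h j i = meshCell h i j := by
  ext z
  simp only [meshCell, mem_preimage, mem_prod, Prod.fst_swap, Prod.snd_swap]
  exact and_comm

theorem volume_meshCell_inter_conjPlane (hΩ : MeasurableSet Ω) (h : ℝ) (i j : ℤ) :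
    volume (meshCell h i j ∩ conjPlane ⁻¹' Ω) = volume (meshCell h i (-j - 1) ∩ Ω) := by
  rw [← preimage_conjPlane_meshCell, ← preimage_inter]
  exact measurePreserving_conj.measure_preimage
    ((measurableSet_meshCell _ _ _).inter hΩ).nullMeasurableSet

theorem volume_meshCell_inter_swap (hΩ : MeasurableSet Ω) (h : ℝ) (i j : ℤ) :
    volume (meshCell h i j ∩ Prod.swap ⁻¹' Ω) = volume (meshCell h j i ∩ Ω) := by
  rw [← preimage_swap_meshCell, ← preimage_inter]
  exact measurePreserving_swap_plane.measure_preimage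
    ((measurableSet_meshCell _ _ _).inter hΩ).nullMeasurableSet

theorem cellAverage_conjPlane (hΩ : MeasurableSet Ω) (hh : 0 < h) (i j : ℤ) :
    cellAverage (conjPlane ⁻¹' Ω) h i j = cellAverage Ω h i (-j - 1) := by
  rw [cellAverage_eq (continuous_conjPlane.measurable hΩ) hh, cellAverage_eq hΩ hh,
    measureReal_def, measureReal_def, volume_meshCell_inter_conjPlane hΩ]

theorem cellAverage_swap (hΩ : MeasurableSet Ω) (hh : 0 < h) (i j : ℤ) :
    cellAverage (Prod.swap ⁻¹' Ω) h i j = cellAverage Ω h j i := by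
  rw [cellAverage_eq (continuous_swap.measurable hΩ) hh, cellAverage_eq hΩ hh,
    measureReal_def, measureReal_def, volume_meshCell_inter_swap hΩ]

theorem sobelH_conjPlane (hΩ : MeasurableSet Ω) (hh : 0 < h) (i j : ℤ) :
    sobelH (conjPlane ⁻¹' Ω) h i (-j - 1) = sobelH Ω h i j := by
  simp only [sobelH, cellAverage_conjPlane hΩ hh]
  rw [show -(-j - 1) - 1 = j by ring, show -(-j - 1 + 1) - 1 = j - 1 by ring,
    show -(-j - 1 - 1) - 1 = j + 1 by ring]
  ring

theorem sobelV_conjPlane (hΩ : MeasurableSet Ω) (hh : 0 < h) (i j : ℤ) :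
    sobelV (conjPlane ⁻¹' Ω) h i (-j - 1) = -sobelV Ω h i j := by
  simp only [sobelV, cellAverage_conjPlane hΩ hh]
  rw [show -(-j - 1 + 1) - 1 = j - 1 by ring, show -(-j - 1 - 1) - 1 = j + 1 by ring]
  ring

theorem sobelH_swap (hΩ : MeasurableSet Ω) (hh : 0 < h) (i j : ℤ) :
    sobelH (Prod.swap ⁻¹' Ω) h j i = sobelV Ω h i j := by
  simp only [sobelH, sobelV, cellAverage_swap hΩ hh]

theorem sobelV_swap (hΩ : MeasurableSet Ω) (hh : 0 < h) (i j : ℤ) :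
    sobelV (Prod.swap ⁻¹' Ω) h j i = sobelH Ω h i j := by
  simp only [sobelH, sobelV, cellAverage_swap hΩ hh]

theorem IsSingularCell.conjPlane (hΩ : MeasurableSet Ω) (hT : IsSingularCell Ω h i j) :
    IsSingularCell (conjPlane ⁻¹' Ω) h i (-j - 1) := by
  have e : -(-j - 1) - 1 = j := by ring
  refine ⟨?_, ?_⟩
  · rw [volume_meshCell_inter_conjPlane hΩ, e]
    exact hT.1
  · rw [← preimage_compl, volume_meshCell_inter_conjPlane hΩ.compl, e]
    exact hT.2

theorem IsSingularCell.swap (hΩ : MeasurableSet Ω) (hT : IsSingularCell Ω h i j) :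
    IsSingularCell (Prod.swap ⁻¹' Ω) h j i := by
  refine ⟨?_, ?_⟩
  · rw [volume_meshCell_inter_swap hΩ]
    exact hT.1
  · rw [← preimage_compl, volume_meshCell_inter_swap hΩ.compl]
    exact hT.2

theorem NearHalfPlane.conjPlane (hH : NearHalfPlane Ω n z₀ h ε) :
    NearHalfPlane (conjPlane ⁻¹' Ω) (conjPlane n) (conjPlane z₀) h ε := by
  intro z h1 h2
  have e : normalForm (_root_.conjPlane n) (_root_.conjPlane z₀) z =
      normalForm n z₀ (_root_.conjPlane z) := by
    simp only [normalForm, _root_.conjPlane]; ring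
  rw [e]
  refine hH (_root_.conjPlane z) h1 ?_
  simp only [_root_.conjPlane] at h2 ⊢
  rw [abs_sub_comm]
  convert h2 using 2
  ring

theorem NearHalfPlane.swap (hH : NearHalfPlane Ω n z₀ h ε) :
    NearHalfPlane (Prod.swap ⁻¹' Ω) n.swap z₀.swap h ε := by
  intro z h1 h2
  have e : normalForm n.swap z₀.swap z = normalForm n z₀ z.swap := by
    simp only [normalForm, Prod.fst_swap, Prod.snd_swap]; ring
  rw [e]
  exact hH z.swap h2 h1

theorem IsHolderDomain.preimage {L : (ℝ × ℝ) →ₗ[ℝ] ℝ × ℝ} (hΩ : IsHolderDomain s Ω)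
    (hL : Continuous L) (hinv : Function.Involutive L)
    (horth : ∀ e₁ e₂, IsOrthonormalPair e₁ e₂ → IsOrthonormalPair (L e₁) (L e₂)) :
    IsHolderDomain s (L ⁻¹' Ω) := by
  obtain ⟨R, P, M, hR, hP, hM, H⟩ := hΩ
  refine ⟨R, P, M, hR, hP, hM, fun z₀ hz₀ => ?_⟩
  have hf : L z₀ ∈ frontier Ω := by
    let e : (ℝ × ℝ) ≃ₜ ℝ × ℝ := ⟨hinv.toPerm, hL, hL⟩
    have := e.preimage_frontier Ω
    change L ⁻¹' frontier Ω = frontier (L ⁻¹' Ω) at this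
    rw [← this] at hz₀
    exact hz₀
  obtain ⟨e₁, e₂, ψ, he, h1, h2, h3⟩ := H _ hf
  refine ⟨L e₁, L e₂, ψ, horth _ _ he, h1, h2, fun t₁ t₂ ht₁ ht₂ => ?_⟩
  rw [← h3 t₁ t₂ ht₁ ht₂, mem_preimage, map_add, map_add, map_smul, map_smul, hinv, hinv]

theorem IsHolderDomain.swap (hΩ : IsHolderDomain s Ω) : IsHolderDomain s (Prod.swap ⁻¹' Ω) :=
  hΩ.preimage (L := (LinearEquiv.prodComm ℝ ℝ ℝ).toLinearMap) continuous_swap Prod.swap_swap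
    fun e₁ e₂ ⟨h1, h2, h3⟩ => ⟨by simpa [add_comm] using h1, by simpa [add_comm] using h2,
      by simpa [add_comm] using h3⟩

theorem IsHolderDomain.conjPlane (hΩ : IsHolderDomain s Ω) :
    IsHolderDomain s (conjPlane ⁻¹' Ω) :=
  hΩ.preimage (L := LinearMap.prodMap LinearMap.id (-LinearMap.id)) continuous_conjPlane
    conjPlane_involutive
    fun e₁ e₂ ⟨h1, h2, h3⟩ => ⟨by simpa using h1, by simpa using h2, by simpa using h3⟩

end Symmetry

/-- If the Sobel gradient points down, then so does the inner normal, up to `45` degrees and a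
small error. -/
theorem abs_sub_lt_of_sobelV_le {Ω : Set (ℝ × ℝ)} {n z₀ : ℝ × ℝ} {h ε δ K : ℝ} {i j : ℤ}
    (hΩ : MeasurableSet Ω) (hh : 0 < h) (hz₀ : z₀ ∈ meshCell h i j)
    (hδ : 0 < δ) (hε : 0 ≤ ε) (hK : |n.1| + |n.2| ≤ K)
    (hsmall : 1000 * K ^ 2 * ε < δ ^ 3) (hH : NearHalfPlane Ω n z₀ h ε)
    (hHV : |sobelH Ω h i j| ≤ |sobelV Ω h i j|) (hV : sobelV Ω h i j ≤ 0) :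
    |n.1| - δ < n.2 := by
  rw [abs_of_nonpos hV, abs_le] at hHV
  have c1 : n.1 - n.2 < δ := by
    by_contra! hn
    have := sobelH_lt_sobelV hΩ hh hz₀ hδ hε hK hn hsmall hH
    linarith
  have c2 : -n.1 - n.2 < δ := by
    by_contra! hn
    have hΩ₁ : MeasurableSet (Prod.swap ⁻¹' Ω) := continuous_swap.measurable hΩ
    have hΩ₂ : MeasurableSet (conjPlane ⁻¹' (Prod.swap ⁻¹' Ω)) :=
      continuous_conjPlane.measurable hΩ₁
    have hΩ₃ : MeasurableSet (Prod.swap ⁻¹' (conjPlane ⁻¹' (Prod.swap ⁻¹' Ω))) :=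
      continuous_swap.measurable hΩ₂
    have hz₃ : (conjPlane z₀.swap).swap ∈ meshCell h (-i - 1) j := by
      rw [← mem_preimage, preimage_swap_meshCell, ← mem_preimage, preimage_conjPlane_meshCell,
        ← mem_preimage, preimage_swap_meshCell]
      exact hz₀
    have := sobelH_lt_sobelV (K := K) hΩ₃ hh hz₃ hδ hε (by simpa [conjPlane] using hK)
      (by simpa [conjPlane] using hn) hsmall hH.swap.conjPlane.swap
    rw [sobelH_swap hΩ₂ hh, sobelV_swap hΩ₂ hh, sobelH_conjPlane hΩ₁ hh, sobelV_conjPlane hΩ₁ hh,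
      sobelH_swap hΩ hh, sobelV_swap hΩ hh] at this
    linarith
  have : |n.1| < n.2 + δ := abs_lt.2 ⟨by linarith, by linarith⟩
  linarith

theorem IsOrthonormalPair.exists_orientation {e₁ e₂ : ℝ × ℝ} (he : IsOrthonormalPair e₁ e₂) :
    ∃ σ : ℝ, (σ = 1 ∨ σ = -1) ∧ e₂.1 = -σ * e₁.2 ∧ e₂.2 = σ * e₁.1 := by
  obtain ⟨h1, h2, h3⟩ := he
  refine ⟨e₁.1 * e₂.2 - e₁.2 * e₂.1, ?_, ?_, ?_⟩
  · rw [← sq_eq_one_iff]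
    linear_combination (e₂.1 ^ 2 + e₂.2 ^ 2) * h1 + h2 - (e₁.1 * e₂.1 + e₁.2 * e₂.2) * h3
  · linear_combination -e₂.1 * h1 + e₁.1 * h3
  · linear_combination -e₂.2 * h1 + e₁.2 * h3

theorem abs_normalForm_le {n z₀ z : ℝ × ℝ} {A B : ℝ} (hn : n.1 ^ 2 + n.2 ^ 2 = 1)
    (h1 : |z.1 - z₀.1| ≤ A) (h2 : |z.2 - z₀.2| ≤ B) : |normalForm n z₀ z| ≤ A + B := by
  have n1 : |n.1| ≤ 1 := abs_le_one_iff_mul_self_le_one.2 (by nlinarith [sq_nonneg n.2])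
  have n2 : |n.2| ≤ 1 := abs_le_one_iff_mul_self_le_one.2 (by nlinarith [sq_nonneg n.1])
  refine (abs_add_le _ _).trans ?_
  rw [abs_mul, abs_mul]
  have := mul_le_mul n1 h1 (abs_nonneg _) zero_le_one
  have := mul_le_mul n2 h2 (abs_nonneg _) zero_le_one
  linarith

theorem continuous_normalForm (n z₀ : ℝ × ℝ) : Continuous (normalForm n z₀) := by
  unfold normalForm; fun_prop

theorem mem_iff_normalForm_le {e₁ e₂ : ℝ × ℝ} (he : IsOrthonormalPair e₁ e₂) {Ω : Set (ℝ × ℝ)}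
    {z₀ : ℝ × ℝ} {A B : ℝ} {ψ : ℝ → ℝ}
    (H : ∀ t₁ t₂ : ℝ, |t₁| ≤ A → |t₂| ≤ B → (z₀ + t₁ • e₁ + t₂ • e₂ ∈ Ω ↔ t₂ ≤ ψ t₁))
    {z : ℝ × ℝ} (h1 : |normalForm e₁ z₀ z| ≤ A) (h2 : |normalForm e₂ z₀ z| ≤ B) :
    z ∈ Ω ↔ normalForm e₂ z₀ z ≤ ψ (normalForm e₁ z₀ z) := by
  rw [← H _ _ h1 h2]
  obtain ⟨σ, hσ, g1, g2⟩ := he.exists_orientation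
  have hσ2 : σ ^ 2 = 1 := sq_eq_one_iff.2 hσ
  have hh := he.1
  suffices e : z₀ + normalForm e₁ z₀ z • e₁ + normalForm e₂ z₀ z • e₂ = z by rw [e]
  ext
  · simp only [Prod.fst_add, Prod.smul_fst, smul_eq_mul, normalForm, g1, g2]
    linear_combination (z.1 - z₀.1) * hh +
      ((z.1 - z₀.1) * e₁.2 ^ 2 - (z.2 - z₀.2) * e₁.1 * e₁.2) * hσ2
  · simp only [Prod.snd_add, Prod.smul_snd, smul_eq_mul, normalForm, g1, g2]
    linear_combination (z.2 - z₀.2) * hh +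
      ((z.2 - z₀.2) * e₁.1 ^ 2 - (z.1 - z₀.1) * e₁.1 * e₁.2) * hσ2

/-- The local graph at a boundary point passes through this point. -/
theorem graph_zero_of_mem_frontier {e₁ e₂ : ℝ × ℝ} (he : IsOrthonormalPair e₁ e₂)
    {Ω : Set (ℝ × ℝ)} {z₀ : ℝ × ℝ} (hz₀ : z₀ ∈ frontier Ω) {A B : ℝ} (hA : 0 < A) (hB : 0 < B)
    {ψ : ℝ → ℝ} (hψ : ContinuousOn ψ (Icc (-A) A))
    (H : ∀ t₁ t₂ : ℝ, |t₁| ≤ A → |t₂| ≤ B → (z₀ + t₁ • e₁ + t₂ • e₂ ∈ Ω ↔ t₂ ≤ ψ t₁)) :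
    ψ 0 = 0 := by
  have h0 : ∀ n, normalForm n z₀ z₀ = 0 := fun n => by simp [normalForm]
  have c1 := (continuous_normalForm e₁ z₀).continuousAt (x := z₀)
  have c2 := (continuous_normalForm e₂ z₀).continuousAt (x := z₀)
  have ev1 : ∀ᶠ z in 𝓝 z₀, |normalForm e₁ z₀ z| < A :=
    c1.abs.eventually_lt_const (by simpa [h0] using hA)
  have ev2 : ∀ᶠ z in 𝓝 z₀, |normalForm e₂ z₀ z| < B :=
    c2.abs.eventually_lt_const (by simpa [h0] using hB)
  have c3 : ContinuousAt (fun z => normalForm e₂ z₀ z - ψ (normalForm e₁ z₀ z)) z₀ := by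
    refine c2.sub (ContinuousAt.comp (g := ψ) ?_ c1)
    rw [h0]
    exact hψ.continuousAt (Icc_mem_nhds (by linarith) hA)
  rcases lt_trichotomy (ψ 0) 0 with h | h | h
  · exfalso
    have ev3 := c3.eventually_const_lt (u := 0) (by simp only [h0]; linarith)
    refine (mem_closure_iff_frequently.1 (frontier_subset_closure hz₀)) ?_
    filter_upwards [ev1, ev2, ev3] with z z1 z2 z3
    rw [mem_iff_normalForm_le he H z1.le z2.le]
    linarith
  · exact h
  · exfalso
    have ev3 := c3.eventually_lt_const (u := 0) (by simp only [h0]; linarith)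
    refine hz₀.2 (mem_interior_iff_mem_nhds.2 ?_)
    filter_upwards [ev1, ev2, ev3] with z z1 z2 z3
    rw [mem_iff_normalForm_le he H z1.le z2.le]
    linarith

theorem IsHolderDomain.isClosed {s : ℝ} {Ω : Set (ℝ × ℝ)} (hΩ : IsHolderDomain s Ω) :
    IsClosed Ω := by
  obtain ⟨R, P, M, hR, hP, hM, H⟩ := hΩ
  refine isClosed_of_closure_subset fun z hz => ?_
  by_contra hzΩ
  have hf : z ∈ frontier Ω := ⟨hz, fun h => hzΩ (interior_subset h)⟩
  obtain ⟨e₁, e₂, ψ, he, h1, -, h3⟩ := H z hf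
  have h0 := graph_zero_of_mem_frontier he hf hR (by positivity) h1.1.continuousOn h3
  refine hzΩ ?_
  have := (h3 0 0 (by simpa using hR.le) (by simpa using (by positivity : 0 ≤ P * R))).2 h0.ge
  simpa using this

theorem IsSingularCell.exists_mem_frontier {Ω : Set (ℝ × ℝ)} {h : ℝ} {i j : ℤ}
    (hT : IsSingularCell Ω h i j) : ∃ z₀ ∈ meshCell h i j, z₀ ∈ frontier Ω := by
  have hc : IsPreconnected (meshCell h i j) := isPreconnected_Icc.prod isPreconnected_Icc
  by_contra! hcon
  obtain ⟨x, hx, hxΩ⟩ := nonempty_of_measure_ne_zero hT.1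
  obtain ⟨y, hy, hyΩ⟩ := nonempty_of_measure_ne_zero hT.2
  have hsub : meshCell h i j ⊆ interior Ω ∪ (closure Ω)ᶜ := by
    intro z hz
    by_contra hz'
    rw [mem_union, not_or, mem_compl_iff, not_not] at hz'
    exact hcon z hz ⟨hz'.2, hz'.1⟩
  obtain ⟨z, -, h1, h2⟩ := hc _ _ isOpen_interior isClosed_closure.isOpen_compl hsub
    ⟨x, hx, (hsub hx).resolve_right fun h => h (subset_closure hxΩ)⟩
    ⟨y, hy, (hsub hy).resolve_left fun h => hyΩ (interior_subset h)⟩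
  exact h2 (subset_closure (interior_subset h1))

theorem abs_sub_linear_le {r η p : ℝ} {ψ g : ℝ → ℝ}
    (hd : ∀ t ∈ Icc (-r) r, HasDerivWithinAt ψ (g t) (Icc (-r) r) t)
    (hg : ∀ t ∈ Icc (-r) r, |g t - p| ≤ η) {t t' : ℝ} (ht : t ∈ Icc (-r) r)
    (ht' : t' ∈ Icc (-r) r) : |ψ t' - ψ t - p * (t' - t)| ≤ η * |t' - t| := by
  have h1 : ∀ x ∈ Icc (-r) r,
      HasDerivWithinAt (fun x => ψ x - p * x) (g x - p) (Icc (-r) r) x := fun x hx => by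
    simpa using (hd x hx).fun_sub ((hasDerivWithinAt_id x (Icc (-r) r)).const_mul p)
  have h2 := (convex_Icc (-r) r).norm_image_sub_le_of_norm_hasDerivWithin_le h1 hg ht ht'
  rw [Real.norm_eq_abs, Real.norm_eq_abs] at h2
  convert h2 using 2
  ring

theorem one_third_le_of_abs_sub_lt {a b δ : ℝ} (hab : 1 ≤ a ^ 2 + b ^ 2) (hδ : 0 < δ)
    (hδ1 : δ ≤ 1 / 4) (h : |a| - δ < b) : 1 / 3 ≤ b := by
  by_contra! hb
  have h0 := abs_nonneg a
  have h1 : |a| < 1 / 3 + 1 / 4 := by linarith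
  have h2 : |b| ≤ 1 / 3 := abs_le.2 ⟨by linarith, hb.le⟩
  have := abs_nonneg b
  rw [← sq_abs a, ← sq_abs b] at hab
  nlinarith

set_option maxHeartbeats 1000000 in
/-- In a stencil, a domain bounded by a nearly straight curve of inner normal close enough to
the downward direction is a subgraph. -/
theorem exists_graph_of_chart {s : ℝ} (hs : 1 < s) {k m : ℕ} {Ω : Set (ℝ × ℝ)}
    {h r η p δ : ℝ} {i j : ℤ} {z₀ e₁ e₂ : ℝ × ℝ} {ψ g : ℝ → ℝ} (hh : 0 < h)
    (he : IsOrthonormalPair e₁ e₂) (hψ0 : ψ 0 = 0)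
    (hd : ∀ t ∈ Icc (-r) r, HasDerivWithinAt ψ (g t) (Icc (-r) r) t)
    (hg : ∀ t ∈ Icc (-r) r, |g t - p| ≤ η) (hm : holderOrder s = m + 1)
    (hreg : HolderRec (s - holderOrder s) (Icc (-r) r) m g)
    (hloc : ∀ z, |normalForm e₁ z₀ z| ≤ r → |normalForm e₂ z₀ z| ≤ r →
      (z ∈ Ω ↔ normalForm e₂ z₀ z ≤ ψ (normalForm e₁ z₀ z)))
    (hz₀ : z₀ ∈ meshCell h i j) (hr : 2 * (k + 3) * h ≤ r) (hη : 0 ≤ η)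
    (hηk : 24 * (k + 3) * η ≤ 1) (hδ : 0 < δ) (hδk : 12 * (k + 1) * δ ≤ 1)
    (hN : |e₂.1 - p * e₁.1| - δ < e₂.2 - p * e₁.2) :
    ∃ φ : ℝ → ℝ, HolderClass s (stencilInterval h i k) φ ∧
      (∀ z ∈ stencilSupport h i j k (k + 2), z ∈ Ω ↔ z.2 ≤ φ z.1) ∧
      MapsTo φ (stencilInterval h i k) (stencilInterval h j (k + 2)) := by
  have hk0 : (0 : ℝ) ≤ k := Nat.cast_nonneg k
  obtain ⟨σ, hσ, g1, g2⟩ := he.exists_orientation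
  have hσ2 : σ ^ 2 = 1 := sq_eq_one_iff.2 hσ
  have hσa : |σ| = 1 := by rcases hσ with rfl | rfl <;> simp
  obtain ⟨he1, he2, he3⟩ := he
  set N₁ := e₂.1 - p * e₁.1 with hN₁
  set N₂ := e₂.2 - p * e₁.2 with hN₂
  have hN1 : 1 ≤ N₁ ^ 2 + N₂ ^ 2 := by
    have : N₁ ^ 2 + N₂ ^ 2 = 1 + p ^ 2 := by
      rw [hN₁, hN₂]
      linear_combination he2 - 2 * p * he3 + p ^ 2 * he1
    rw [this]
    nlinarith [sq_nonneg p]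
  have hN3 : 1 / 3 ≤ N₂ :=
    one_third_le_of_abs_sub_lt hN1 hδ (by nlinarith [mul_nonneg hk0 hδ.le]) hN
  have hη1 : η ≤ 1 / 72 := by nlinarith [mul_nonneg hk0 hη]
  have hr0 : 0 < r := lt_of_lt_of_le (by positivity) hr
  have h0r : (0 : ℝ) ∈ Icc (-r) r := ⟨by linarith, hr0.le⟩
  have lin : ∀ {t t'}, t ∈ Icc (-r) r → t' ∈ Icc (-r) r →
      |ψ t' - ψ t - p * (t' - t)| ≤ η * |t' - t| := fun ht ht' => abs_sub_linear_le hd hg ht ht'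
  have hψc : ContinuousOn ψ (Icc (-r) r) := fun t ht => (hd t ht).continuousWithinAt
  have e12 : |e₁.2| ≤ 1 := abs_le_one_iff_mul_self_le_one.2 (by nlinarith [sq_nonneg e₁.1])
  have e21 : |e₂.1| ≤ 1 := abs_le_one_iff_mul_self_le_one.2 (by nlinarith [sq_nonneg e₂.2])
  set I := stencilInterval h i k with hI
  set J := stencilInterval h j (k + 2) with hJ
  set jb := (j - ((k + 2 : ℕ) : ℝ)) * h with hjb
  set jt := (j + ((k + 2 : ℕ) : ℝ) + 1) * h with hjt
  obtain ⟨⟨z1, z2⟩, z3, z4⟩ := hz₀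
  have dx : ∀ x ∈ I, |x - z₀.1| ≤ (k + 1) * h := by
    rintro x ⟨h1, h2⟩
    rw [abs_le]
    constructor <;> linarith
  have dy : ∀ y ∈ J, |y - z₀.2| ≤ (k + 3) * h := by
    rintro y ⟨h1, h2⟩
    push_cast at h1 h2
    rw [abs_le]
    constructor <;> linarith
  have bnd : ∀ n : ℝ × ℝ, n.1 ^ 2 + n.2 ^ 2 = 1 → ∀ x ∈ I, ∀ y ∈ J,
      |normalForm n z₀ (x, y)| ≤ 2 * (k + 3) * h := by
    intro n hn x hx y hy
    refine (abs_normalForm_le (z := (x, y)) hn (dx x hx) (dy y hy)).trans ?_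
    linarith
  have memr : ∀ x ∈ I, ∀ y ∈ J, normalForm e₁ z₀ (x, y) ∈ Icc (-r) r := fun x hx y hy =>
    abs_le.1 ((bnd e₁ he1 x hx y hy).trans hr)
  set Φ : ℝ → ℝ → ℝ := fun x y => normalForm e₂ z₀ (x, y) - ψ (normalForm e₁ z₀ (x, y)) with hΦ
  have hΩ : ∀ x ∈ I, ∀ y ∈ J, ((x, y) ∈ Ω ↔ Φ x y ≤ 0) := fun x hx y hy => by
    rw [hloc (x, y) ((bnd e₁ he1 x hx y hy).trans hr) ((bnd e₂ he2 x hx y hy).trans hr), hΦ,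
      sub_nonpos]
  have mono : ∀ x ∈ I, ∀ y ∈ J, ∀ y' ∈ J, y < y' → Φ x y < Φ x y' := by
    intro x hx y hy y' hy' hyy
    have h1 := lin (memr x hx y hy) (memr x hx y' hy')
    have e1 : normalForm e₁ z₀ (x, y') - normalForm e₁ z₀ (x, y) = e₁.2 * (y' - y) := by
      simp only [normalForm]; ring
    rw [e1, abs_mul, abs_of_pos (sub_pos.2 hyy)] at h1
    have e2 : Φ x y' - Φ x y = N₂ * (y' - y) -
        (ψ (normalForm e₁ z₀ (x, y')) - ψ (normalForm e₁ z₀ (x, y)) - p * (e₁.2 * (y' - y))) := by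
      simp only [hΦ, hN₂, normalForm]; ring
    have h2 : η * (|e₁.2| * (y' - y)) ≤ 1 / 72 * (1 * (y' - y)) := by
      have := sub_pos.2 hyy
      gcongr
    have h3 := (abs_le.1 h1).2
    have h4 : 1 / 3 * (y' - y) ≤ N₂ * (y' - y) := by
      have := sub_pos.2 hyy
      gcongr
    linarith [sub_pos.2 hyy]
  have near : ∀ x ∈ I, ∀ y ∈ J,
      |Φ x y - (N₁ * (x - z₀.1) + N₂ * (y - z₀.2))| ≤ h / 12 := by
    intro x hx y hy
    have h1 := lin h0r (memr x hx y hy)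
    rw [hψ0] at h1
    rw [abs_sub_comm]
    calc _ = _ := by
          congr 1
          simp only [hΦ, hN₁, hN₂, normalForm]
          ring
      _ ≤ _ := h1
      _ ≤ η * (2 * (k + 3) * h) := by
          rw [sub_zero]
          exact mul_le_mul_of_nonneg_left (bnd e₁ he1 x hx y hy) hη
      _ ≤ h / 12 := by linarith [mul_le_mul_of_nonneg_right hηk hh.le]
  have hjJ : jb ≤ jt := by
    rw [hjb, hjt]
    refine mul_le_mul_of_nonneg_right ?_ hh.le
    linarith [(Nat.cast_nonneg _ : (0 : ℝ) ≤ ((k + 2 : ℕ) : ℝ))]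
  have slope : ∀ x ∈ I, |N₁ * (x - z₀.1)| ≤ N₂ * ((k + 1) * h) + h / 12 := by
    intro x hx
    rw [abs_mul]
    have h1 : |N₁| * |x - z₀.1| ≤ (N₂ + δ) * ((k + 1) * h) :=
      mul_le_mul (by linarith) (dx x hx) (abs_nonneg _) (by linarith)
    have h2 : 12 * (k + 1) * δ * h ≤ 1 * h := mul_le_mul_of_nonneg_right hδk hh.le
    linarith
  have hNh : h / 3 ≤ N₂ * h := by
    have := mul_le_mul_of_nonneg_right hN3 hh.le
    linarith
  have exφ : ∀ x ∈ I, ∃ y, y ∈ J ∧ Φ x y = 0 := by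
    intro x hx
    have s1 := abs_le.1 (slope x hx)
    have t1 := abs_le.1 (near x hx jb ⟨le_rfl, hjJ⟩)
    have t2 := abs_le.1 (near x hx jt ⟨hjJ, le_rfl⟩)
    have b1 : N₂ * (jb - z₀.2) ≤ N₂ * (-((k + 2) * h)) := by
      refine mul_le_mul_of_nonneg_left ?_ (by linarith)
      rw [hjb]; push_cast; linarith
    have b2 : N₂ * ((k + 2) * h) ≤ N₂ * (jt - z₀.2) := by
      refine mul_le_mul_of_nonneg_left ?_ (by linarith)
      rw [hjt]; push_cast; linarith
    have hcont : ContinuousOn (Φ x) (Icc jb jt) := by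
      have c1 : ∀ n, Continuous fun y : ℝ => normalForm n z₀ (x, y) := fun n =>
        (continuous_normalForm n z₀).comp (by fun_prop)
      exact (c1 e₂).continuousOn.sub
        (hψc.comp (c1 e₁).continuousOn fun y hy => memr x hx y hy)
    obtain ⟨y, hy, hy0⟩ := intermediate_value_Icc hjJ hcont
      (⟨by linarith, by linarith⟩ : (0 : ℝ) ∈ Icc (Φ x jb) (Φ x jt))
    exact ⟨y, hy, hy0⟩
  choose! φ hφJ hφ0 using exφ
  set τ : ℝ → ℝ := fun x => normalForm e₁ z₀ (x, φ x) with hτ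
  set X : ℝ → ℝ := fun t => z₀.1 + t * e₁.1 + ψ t * e₂.1 with hX
  set Y : ℝ → ℝ := fun t => z₀.2 + t * e₁.2 + ψ t * e₂.2 with hY
  have hτr : MapsTo τ I (Icc (-r) r) := fun x hx => memr x hx _ (hφJ x hx)
  have hψτ : ∀ x ∈ I, ψ (τ x) = normalForm e₂ z₀ (x, φ x) := fun x hx => by
    have := hφ0 x hx
    simp only [hΦ] at this
    linarith
  have hXτ : ∀ x ∈ I, X (τ x) = x := fun x hx => by
    simp only [hX, hψτ x hx]
    simp only [hτ, normalForm, g1, g2]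
    linear_combination (x - z₀.1) * he1 +
      ((x - z₀.1) * e₁.2 ^ 2 - (φ x - z₀.2) * e₁.1 * e₁.2) * hσ2
  have hYτ : ∀ x ∈ I, Y (τ x) = φ x := fun x hx => by
    simp only [hY, hψτ x hx]
    simp only [hτ, normalForm, g1, g2]
    linear_combination (φ x - z₀.2) * he1 +
      ((φ x - z₀.2) * e₁.1 ^ 2 - (x - z₀.1) * e₁.1 * e₁.2) * hσ2
  have hσN : σ * (e₁.1 + p * e₂.1) = N₂ := by
    rw [hN₂, g1, g2]
    linear_combination -p * e₁.2 * hσ2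
  have hNa : 1 / 3 ≤ |e₁.1 + p * e₂.1| := by
    have : |σ * (e₁.1 + p * e₂.1)| = |e₁.1 + p * e₂.1| := by rw [abs_mul, hσa, one_mul]
    rw [← this, hσN]
    exact hN3.trans (le_abs_self _)
  have hX' : ∀ t ∈ Icc (-r) r, HasDerivWithinAt X (e₁.1 + g t * e₂.1) (Icc (-r) r) t := by
    intro t ht
    have h1 := ((hasDerivWithinAt_id t (Icc (-r) r)).mul_const e₁.1).const_add z₀.1
    simpa using h1.fun_add ((hd t ht).mul_const e₂.1)
  have hY' : ∀ t ∈ Icc (-r) r, HasDerivWithinAt Y (e₁.2 + g t * e₂.2) (Icc (-r) r) t := by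
    intro t ht
    have h1 := ((hasDerivWithinAt_id t (Icc (-r) r)).mul_const e₁.2).const_add z₀.2
    simpa using h1.fun_add ((hd t ht).mul_const e₂.2)
  have hXc : ∀ t ∈ Icc (-r) r, 1 / 4 ≤ |e₁.1 + g t * e₂.1| := by
    intro t ht
    have h1 : |(g t - p) * e₂.1| ≤ 1 / 72 * 1 := by
      rw [abs_mul]
      exact mul_le_mul ((hg t ht).trans hη1) e21 (abs_nonneg _) (by norm_num)
    have h2 := abs_sub_abs_le_abs_sub (e₁.1 + p * e₂.1) (-((g t - p) * e₂.1))
    rw [abs_neg, show e₁.1 + p * e₂.1 - -((g t - p) * e₂.1) = e₁.1 + g t * e₂.1 by ring] at h2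
    linarith
  have hlip : ∀ x ∈ I, ∀ y ∈ I, |τ x - τ y| ≤ 4 * |x - y| := by
    intro x hx y hy
    have h1 := lin (hτr hy) (hτr hx)
    have h2 : |e₂.1 * (ψ (τ x) - ψ (τ y) - p * (τ x - τ y))| ≤ 1 * (1 / 72 * |τ x - τ y|) := by
      rw [abs_mul]
      exact mul_le_mul e21 (h1.trans (mul_le_mul_of_nonneg_right hη1 (abs_nonneg _)))
        (abs_nonneg _) zero_le_one
    have h3 := abs_sub_abs_le_abs_sub ((e₁.1 + p * e₂.1) * (τ x - τ y))
      (-(e₂.1 * (ψ (τ x) - ψ (τ y) - p * (τ x - τ y))))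
    have h4 : (e₁.1 + p * e₂.1) * (τ x - τ y) -
        -(e₂.1 * (ψ (τ x) - ψ (τ y) - p * (τ x - τ y))) = x - y := by
      conv_rhs => rw [← hXτ x hx, ← hXτ y hy]
      simp only [hX]
      ring
    rw [h4, abs_neg, abs_mul] at h3
    have h5 := mul_le_mul_of_nonneg_right hNa (abs_nonneg (τ x - τ y))
    linarith [abs_nonneg (τ x - τ y)]
  have ha := holderOrder_lt hs
  have ha1 := sub_holderOrder_le hs
  have hτreg : HolderRec (s - holderOrder s) I (m + 1) τ :=
    HolderRec.rightInverse ha ha1 hX'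
      ((HolderRec.const e₁.1).add (hreg.mul ha ha1 (HolderRec.const e₂.1))) (by norm_num) hXc hτr
      (by norm_num) hlip hXτ
  have hYreg : HolderRec (s - holderOrder s) (Icc (-r) r) (m + 1) Y :=
    ⟨_, hY', (HolderRec.const e₁.2).add (hreg.mul ha ha1 (HolderRec.const e₂.2))⟩
  have hφreg : HolderRec (s - holderOrder s) I (m + 1) φ :=
    (hYreg.comp ha ha1 hτreg hτr (by norm_num) hlip).congr fun x hx => (hYτ x hx).symm
  refine ⟨φ, HolderRec.holderClass ha (mul_lt_mul_of_pos_right (by linarith) hh) (by rwa [hm] at hφreg ⊢), ?_, hφJ⟩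
  rintro ⟨x, y⟩ hz
  rw [stencilSupport_eq hh] at hz
  obtain ⟨hx, hy⟩ := hz
  rw [hΩ x hx y hy, ← hφ0 x hx]
  constructor
  · intro h1
    by_contra! h2
    exact absurd (mono x hx _ (hφJ x hx) y hy h2) (not_lt.2 h1)
  · intro h1
    rcases eq_or_lt_of_le h1 with h1 | h1
    · rw [← h1]
    · exact (mono x hx y hy _ (hφJ x hx) h1).le

theorem exists_subgraph_of_sobelV_nonpos {s : ℝ} (hs : 1 < s) (k : ℕ) {Ω : Set (ℝ × ℝ)}
    (hΩ : IsHolderDomain s Ω) :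
    ∃ hstar : ℝ, 0 < hstar ∧ ∀ h : ℝ, 0 < h → h < hstar → ∀ i j : ℤ, IsSingularCell Ω h i j →
      |sobelH Ω h i j| ≤ |sobelV Ω h i j| → sobelV Ω h i j ≤ 0 →
        ∃ ψ : ℝ → ℝ, HolderClass s (stencilInterval h i k) ψ ∧
          (∀ z ∈ stencilSupport h i j k (k + 2), z ∈ Ω ↔ z.2 ≤ ψ z.1) ∧
          MapsTo ψ (stencilInterval h i k) (stencilInterval h j (k + 2)) := by
  have hmeas : MeasurableSet Ω := hΩ.isClosed.measurableSet
  obtain ⟨R, P, M, hR, hP, hM, H⟩ := hΩ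
  set δ : ℝ := 1 / (12 * (k + 1)) with hδ
  set K : ℝ := 2 * (1 + M) with hK
  have hδ0 : 0 < δ := by positivity
  have hK0 : 0 < K := by positivity
  set η : ℝ := min (1 / (24 * (k + 3))) (δ ^ 3 / (8000 * K ^ 2)) with hη
  have hη0 : 0 < η := by positivity
  have hηk : 24 * (k + 3) * η ≤ 1 := by
    have : η ≤ 1 / (24 * (k + 3)) := min_le_left _ _
    rw [le_div_iff₀ (by positivity)] at this
    linarith
  have hηδ : 1000 * K ^ 2 * (4 * η) < δ ^ 3 := by
    have : η ≤ δ ^ 3 / (8000 * K ^ 2) := min_le_right _ _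
    rw [le_div_iff₀ (by positivity)] at this
    linarith [pow_pos hδ0 3]
  have hδk : 12 * (k + 1) * δ ≤ 1 := by
    rw [hδ, mul_one_div_cancel (by positivity)]
  obtain ⟨r, hr0, hrR, hr⟩ := exists_radius_derivWithin_near hs hR hM hη0
  refine ⟨r / (2 * (k + 3)), by positivity, fun h hh hlt i j hT hHV hV => ?_⟩
  rw [lt_div_iff₀ (by positivity), mul_comm] at hlt
  obtain ⟨z₀, hz₀, hfr⟩ := hT.exists_mem_frontier
  obtain ⟨e₁, e₂, ψ, he, h1, -, h3⟩ := H z₀ hfr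
  obtain ⟨p, g, hp, hd, hg, m, hm, hreg⟩ := hr ψ h1
  have hPR : R ≤ P * R := by nlinarith
  have hψ0 := graph_zero_of_mem_frontier he hfr hR (by positivity) h1.1.continuousOn h3
  have hloc : ∀ z, |normalForm e₁ z₀ z| ≤ r → |normalForm e₂ z₀ z| ≤ r →
      (z ∈ Ω ↔ normalForm e₂ z₀ z ≤ ψ (normalForm e₁ z₀ z)) := fun z hz1 hz2 =>
    mem_iff_normalForm_le he h3 (hz1.trans hrR) (hz2.trans (hrR.trans hPR))
  have hk0 : (0 : ℝ) ≤ k := Nat.cast_nonneg k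
  have hnear : NearHalfPlane Ω (e₂.1 - p * e₁.1, e₂.2 - p * e₁.2) z₀ h (4 * η) := by
    intro z hz1 hz2
    have b1 := abs_normalForm_le he.1 hz1 hz2
    have b2 := abs_normalForm_le he.2.1 hz1 hz2
    have hr4 : 2 * h + 2 * h ≤ r := by nlinarith
    have h0 : (0 : ℝ) ∈ Icc (-r) r := ⟨by linarith, hr0.le⟩
    have hl := abs_sub_linear_le hd hg h0 (abs_le.1 (b1.trans hr4))
    rw [hψ0, sub_zero, sub_zero] at hl
    have hl2 := hl.trans (mul_le_mul_of_nonneg_left b1 hη0.le)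
    have e : normalForm (e₂.1 - p * e₁.1, e₂.2 - p * e₁.2) z₀ z =
        normalForm e₂ z₀ z - p * normalForm e₁ z₀ z := by
      simp only [normalForm]; ring
    rw [hloc z (b1.trans hr4) (b2.trans hr4), e, not_le]
    rw [abs_le] at hl2
    constructor <;> intro hz <;> linarith
  have hKn : |e₂.1 - p * e₁.1| + |e₂.2 - p * e₁.2| ≤ K := by
    obtain ⟨o1, o2, -⟩ := he
    have q1 : |e₁.1| ≤ 1 := abs_le_one_iff_mul_self_le_one.2 (by nlinarith [sq_nonneg e₁.2])
    have q2 : |e₁.2| ≤ 1 := abs_le_one_iff_mul_self_le_one.2 (by nlinarith [sq_nonneg e₁.1])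
    have q3 : |e₂.1| ≤ 1 := abs_le_one_iff_mul_self_le_one.2 (by nlinarith [sq_nonneg e₂.2])
    have q4 : |e₂.2| ≤ 1 := abs_le_one_iff_mul_self_le_one.2 (by nlinarith [sq_nonneg e₂.1])
    have w1 := abs_sub e₂.1 (p * e₁.1)
    have w2 := abs_sub e₂.2 (p * e₁.2)
    rw [abs_mul] at w1 w2
    have v1 := mul_le_mul hp q1 (abs_nonneg _) hM.le
    have v2 := mul_le_mul hp q2 (abs_nonneg _) hM.le
    linarith
  have hN := abs_sub_lt_of_sobelV_le hmeas hh hz₀ hδ0 (by positivity) hKn hηδ hnear hHV hV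
  exact exists_graph_of_chart hs hh he hψ0 hd hg hm hreg hloc hz₀ hlt.le hη0.le hηk hδ0 hδk hN

theorem HolderClass.neg {s u v : ℝ} (hs : 1 < s) (huv : u < v) {ψ : ℝ → ℝ}
    (hψ : HolderClass s (Icc u v) ψ) : HolderClass s (Icc u v) fun x => -ψ x := by
  obtain ⟨M, hM⟩ := hψ
  refine HolderRec.holderClass (holderOrder_lt hs) huv ?_
  exact ((HolderRec.const (-1)).mul (holderOrder_lt hs) (sub_holderOrder_le hs)
    (hM.holderRec huv)).congr fun x _ => (neg_one_mul _).symm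

theorem neg_mem_stencilInterval {h : ℝ} {j : ℤ} {q : ℕ} {y : ℝ} :
    -y ∈ stencilInterval h (-j - 1) q ↔ y ∈ stencilInterval h j q := by
  simp only [stencilInterval, mem_Icc]
  push_cast
  constructor <;> rintro ⟨h1, h2⟩ <;> constructor <;> linarith

theorem exists_epigraph_of_sobelV_pos {s : ℝ} (hs : 1 < s) (k : ℕ) {Ω : Set (ℝ × ℝ)}
    (hΩ : IsHolderDomain s Ω) :
    ∃ hstar : ℝ, 0 < hstar ∧ ∀ h : ℝ, 0 < h → h < hstar → ∀ i j : ℤ, IsSingularCell Ω h i j →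
      |sobelH Ω h i j| ≤ |sobelV Ω h i j| → 0 < sobelV Ω h i j →
        ∃ ψ : ℝ → ℝ, HolderClass s (stencilInterval h i k) ψ ∧
          (∀ z ∈ stencilSupport h i j k (k + 2), z ∈ Ω ↔ ψ z.1 ≤ z.2) ∧
          MapsTo ψ (stencilInterval h i k) (stencilInterval h j (k + 2)) := by
  have hmeas : MeasurableSet Ω := hΩ.isClosed.measurableSet
  obtain ⟨hstar, h0, H⟩ := exists_subgraph_of_sobelV_nonpos hs k hΩ.conjPlane
  refine ⟨hstar, h0, fun h hh hlt i j hT hHV hV => ?_⟩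
  obtain ⟨ψ, c1, c2, c3⟩ := H h hh hlt i (-j - 1) (hT.conjPlane hmeas)
    (by rwa [sobelH_conjPlane hmeas hh, sobelV_conjPlane hmeas hh, abs_neg])
    (by rw [sobelV_conjPlane hmeas hh]; linarith)
  have hk0 : (0 : ℝ) ≤ k := Nat.cast_nonneg k
  refine ⟨fun x => -ψ x, c1.neg hs (mul_lt_mul_of_pos_right (by linarith) hh), fun z hz => ?_,
    fun x hx => neg_mem_stencilInterval.1 (by rw [neg_neg]; exact c3 hx)⟩
  rw [stencilSupport_eq hh] at hz
  have := c2 (conjPlane z) (by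
    rw [stencilSupport_eq hh]
    exact ⟨hz.1, neg_mem_stencilInterval.2 hz.2⟩)
  rw [mem_preimage, conjPlane_involutive] at this
  rw [this]
  exact neg_le

theorem mainTheorem5 (s : ℝ) (hs : 1 < s) (k : ℕ) (hk : 1 ≤ k)
    (Ω : Set (ℝ × ℝ)) (hΩ : IsHolderDomain s Ω) :
    ∃ hstar : ℝ, 0 < hstar ∧ ∀ h : ℝ, 0 < h → h < hstar →
      ∀ i j : ℤ, IsSingularCell Ω h i j →
        -- case 1: `y ≤ ψ x`
        (|sobelH Ω h i j| ≤ |sobelV Ω h i j| → sobelV Ω h i j ≤ 0 →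
          ∃ ψ : ℝ → ℝ, HolderClass s (stencilInterval h i k) ψ ∧
            (∀ z ∈ stencilSupport h i j k (k + 2), z ∈ Ω ↔ z.2 ≤ ψ z.1) ∧
            MapsTo ψ (stencilInterval h i k) (stencilInterval h j (k + 2))) ∧
        -- case 2: `y ≥ ψ x`
        (|sobelH Ω h i j| ≤ |sobelV Ω h i j| → 0 < sobelV Ω h i j →
          ∃ ψ : ℝ → ℝ, HolderClass s (stencilInterval h i k) ψ ∧
            (∀ z ∈ stencilSupport h i j k (k + 2), z ∈ Ω ↔ ψ z.1 ≤ z.2) ∧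
            MapsTo ψ (stencilInterval h i k) (stencilInterval h j (k + 2))) ∧
        -- case 3: `x ≤ ψ y`
        (|sobelV Ω h i j| < |sobelH Ω h i j| → sobelH Ω h i j ≤ 0 →
          ∃ ψ : ℝ → ℝ, HolderClass s (stencilInterval h j k) ψ ∧
            (∀ z ∈ stencilSupport h i j (k + 2) k, z ∈ Ω ↔ z.1 ≤ ψ z.2) ∧
            MapsTo ψ (stencilInterval h j k) (stencilInterval h i (k + 2))) ∧
        -- case 4: `x ≥ ψ y`
        (|sobelV Ω h i j| < |sobelH Ω h i j| → 0 < sobelH Ω h i j →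
          ∃ ψ : ℝ → ℝ, HolderClass s (stencilInterval h j k) ψ ∧
            (∀ z ∈ stencilSupport h i j (k + 2) k, z ∈ Ω ↔ ψ z.2 ≤ z.1) ∧
            MapsTo ψ (stencilInterval h j k) (stencilInterval h i (k + 2))) := by
  have hmeas : MeasurableSet Ω := hΩ.isClosed.measurableSet
  obtain ⟨h₁, h₁0, H₁⟩ := exists_subgraph_of_sobelV_nonpos hs k hΩ
  obtain ⟨h₂, h₂0, H₂⟩ := exists_epigraph_of_sobelV_pos hs k hΩ
  obtain ⟨h₃, h₃0, H₃⟩ := exists_subgraph_of_sobelV_nonpos hs k hΩ.swap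
  obtain ⟨h₄, h₄0, H₄⟩ := exists_epigraph_of_sobelV_pos hs k hΩ.swap
  refine ⟨min (min h₁ h₂) (min h₃ h₄), by positivity, fun h hh hlt i j hT => ?_⟩
  simp only [lt_min_iff] at hlt
  obtain ⟨⟨hl₁, hl₂⟩, hl₃, hl₄⟩ := hlt
  have hswap : ∀ z ∈ stencilSupport h i j (k + 2) k, z.swap ∈ stencilSupport h j i k (k + 2) := by
    intro z hz
    rw [stencilSupport_eq hh] at hz ⊢
    exact ⟨hz.2, hz.1⟩
  refine ⟨H₁ h hh hl₁ i j hT, H₂ h hh hl₂ i j hT, fun hVH hH => ?_, fun hVH hH => ?_⟩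
  · obtain ⟨ψ, c1, c2, c3⟩ := H₃ h hh hl₃ j i (hT.swap hmeas)
      (by rw [sobelH_swap hmeas hh, sobelV_swap hmeas hh]; exact hVH.le)
      (by rw [sobelV_swap hmeas hh]; exact hH)
    exact ⟨ψ, c1, fun z hz => c2 z.swap (hswap z hz), c3⟩
  · obtain ⟨ψ, c1, c2, c3⟩ := H₄ h hh hl₄ j i (hT.swap hmeas)
      (by rw [sobelH_swap hmeas hh, sobelV_swap hmeas hh]; exact hVH.le)
      (by rw [sobelV_swap hmeas hh]; exact hH)
    exact ⟨ψ, c1, fun z hz => c2 z.swap (hswap z hz), c3⟩
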